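/- Let $\alpha\in[-\tfrac12,0]$ and let $(S_n)_{n\ge0}$ be the random walk on $\mathbb N=\{0,1,2,\dots\}$ associated with the Gegenbauer polynomials of index $\alpha$ and with $\mu=\delta_1$, that is, the birth and death Markov chain with transition probabilities $p(0,1)=1$ and, for $i\ge1$, $$p(i,i+1)=\frac{i+2\alpha+1}{2i+2\alpha+1},\qquad p(i,i-1)=\frac{i}{2i+2\alpha+1}.$$ Let $\mathbb P_x$ be the law of the chain started from $x\in\mathbb N$, and let $N_n(y)=\sum_{k=0}^n \mathbf 1_{\{S_k=y\}}$ be its local time at $y\in\mathbb N$. For $a\in\,]0,1[$ let $\mathcal M(a)$ denote the Mittag-Leffler distribution, the unique probability distribution on $[0,\infty[$ with Laplace transform $s\mapsto\sum_{p\ge0}\frac{(-s)^p}{\Gamma(pa+1)}$, $s\ge0$, and for $r>0$ let $\mathcal E(r)$ denote the exponential distribution with parameter (rate) $r$, i.e. with mean $1/r$. (i) If $\alpha\in[-\tfrac12,0[$, then for all $x,y\in\mathbb N$, under $\mathbb P_x$, as $n\to\infty$, $N_n(y)/n^{|\alpha|}$ converges in law to $$\frac{(2y+2\alpha+1)\,\Gamma(y+2\alpha+1)\,\Gamma(|\alpha|)}{2^{\alpha+1}\,\Gamma(y+1)\,\Gamma(\alpha+1)}\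 \mathcal M(|\alpha|),$$ i.e. to the law of this constant times a random variable with distribution $\mathcal M(|\alpha|)$, where by convention $0\times\Gamma(0)=1$ (this concerns only $\alpha=-\tfrac12$, $y=0$). (ii) If $\alpha=0$, then for all $x,y\in\mathbb N$, under $\mathbb P_x$, as $n\to\infty$, $N_n(y)/\log n$ converges in law to $\mathcal E\!\left(\frac{2}{2y+1}\right)$. -/

import Mathlib

open MeasureTheory ProbabilityTheory Filter

noncomputable section

/-- Transition probabilities of the random walk on `ℕ` associated with the Gegenbauer polynomials
of index `α` and with step distribution `δ₁`: the birth and death chain with `p(0,1) = 1` and, for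
`i ≥ 1`, `p(i,i+1) = (i+2α+1)/(2i+2α+1)`, `p(i,i-1) = i/(2i+2α+1)`. -/
def gegenbauerTransition (α : ℝ) (i j : ℕ) : ℝ :=
  if i = 0 then (if j = 1 then 1 else 0)
  else if j = i + 1 then (i + 2 * α + 1) / (2 * i + 2 * α + 1)
  else if j + 1 = i then i / (2 * i + 2 * α + 1)
  else 0

/-- Under `P`, the process `S` is a homogeneous Markov chain on `ℕ` with transition probabilities
`p` that starts from `x`. The Markov property is written without conditional probabilities:
`P(S₀ = s₀, …, Sₙ₊₁ = sₙ₊₁) = P(S₀ = s₀, …, Sₙ = sₙ) p(sₙ, sₙ₊₁)`. -/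
structure IsMarkovChainFrom {Ω : Type*} [MeasurableSpace Ω] (p : ℕ → ℕ → ℝ) (x : ℕ)
    (P : Measure Ω) (S : ℕ → Ω → ℕ) : Prop where
  measurable : ∀ n, Measurable (S n)
  start : ∀ᵐ ω ∂P, S 0 ω = x
  markov : ∀ (n : ℕ) (s : ℕ → ℕ),
    P {ω | ∀ k ≤ n + 1, S k ω = s k}
      = P {ω | ∀ k ≤ n, S k ω = s k} * ENNReal.ofReal (p (s n) (s (n + 1)))

/-- The local time `Nₙ(y)`: the number of `k ∈ {0, …, n}` with `S_k = y`. -/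
def localTime {Ω : Type*} (S : ℕ → Ω → ℕ) (n y : ℕ) (ω : Ω) : ℕ :=
  ∑ k ∈ Finset.range (n + 1), if S k ω = y then 1 else 0

/-- `M` is a Mittag-Leffler distribution of parameter `a`: a probability distribution on `[0, ∞)`
with Laplace transform `s ↦ ∑ₚ (-s)ᵖ / Γ(p a + 1)`. -/
def IsMittagLeffler (a : ℝ) (M : ProbabilityMeasure ℝ) : Prop :=
  (∀ᵐ t ∂(M : Measure ℝ), 0 ≤ t) ∧
    ∀ s : ℝ, 0 ≤ s →
      HasSum (fun p : ℕ => (-s) ^ p / Real.Gamma (p * a + 1))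
        (∫ t, Real.exp (-s * t) ∂(M : Measure ℝ))

/-- `(2y+2α+1) Γ(y+2α+1)`, with the convention `0 × Γ(0) = 1`, which concerns `y = 0`,
`α = -1/2`. -/
def gegenbauerWeight (α : ℝ) (y : ℕ) : ℝ :=
  if 2 * (y : ℝ) + 2 * α + 1 = 0 then 1
  else (2 * y + 2 * α + 1) * Real.Gamma (y + 2 * α + 1)

/-- The scale `(2y+2α+1) Γ(y+2α+1) Γ(|α|) / (2^(α+1) Γ(y+1) Γ(α+1))` of the limit law. -/
def limitScale (α : ℝ) (y : ℕ) : ℝ :=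
  gegenbauerWeight α y * Real.Gamma |α| /
    ((2 : ℝ) ^ (α + 1) * Real.Gamma (y + 1) * Real.Gamma (α + 1))

instance isProbabilityMeasure_expMeasure_limit (y : ℕ) :
    IsProbabilityMeasure (expMeasure (2 / (2 * (y : ℝ) + 1))) :=
  isProbabilityMeasure_expMeasure (by positivity)

end

/-! The proof is the Darling–Kac method: Laplace transforms in space, Abel sums in time, and a
Tauberian theorem to return to a fixed time.

For `0 < ρ ≤ 1` the first-step equation for `E_x[ρ ^ Nₙ(y)]` gives the discounted sum `∑ zⁿ E_x[ρ ^
Nₙ(y)]` in closed form through the Green function (`tsum_localTimePgf`). Only the behaviour of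
`G_z(x, y)` as `z → 1` then matters. At the origin, `G_z(0, 0)` is an explicit hypergeometric series
in `z²`; comparing its coefficients with those of `(1 - w) ^ (-a)`, where `a = |α|`, or of `-log (1
- w)` when `α = 0`, yields growth of order `m ^ a` or `log m` for `z = exp (-l / m)`. The first-step
equation shows that this does not depend on the starting point, and reversibility multiplies it by
the invariant measure of `y` (`tendsto_green`).

With `ρ = exp (-s / L m)`, where `L` is the normalization, the scaled Abel sums converge to `l⁻¹ (1
+ κ l⁻ᵃ)⁻¹`, which is the Laplace transform of `t ↦ E_a(-κ tᵃ)` (`laplace_mittagLeffler`), or, for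
`α = 0`, to the transform of a constant. Since `E_x[ρ ^ Nₙ(y)]` decreases in `n`, a Karamata
argument (`tendsto_diag_of_abel_sum`) recovers the limit at `n = m`. This is convergence of the
Laplace transforms of the normalized local times, and the continuity theorem
(`exists_tendsto_of_laplace_tendsto`) concludes.

The Mittag-Leffler distribution itself is obtained as a rescaled limit of the local time laws at
`0`; its uniqueness is injectivity of the Laplace transform. -/

/-! ### Laplace transforms of probability measures on the half-line -/

/-- A probability measure on `[0, ∞)` is determined by its Laplace transform at the natural
numbers. -/
theorem laplace_ext {μ ν : Measure ℝ} [IsProbabilityMeasure μ] [IsProbabilityMeasure ν]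
    (hμ : ∀ᵐ t ∂μ, 0 ≤ t) (hν : ∀ᵐ t ∂ν, 0 ≤ t)
    (h : ∀ n : ℕ, ∫ t, Real.exp (-(n : ℝ) * t) ∂μ = ∫ t, Real.exp (-(n : ℝ) * t) ∂ν) : μ = ν := by
  -- Both measures are moved to `NNReal`, where `exp (-t)` is bounded and still separates points, so
  -- that the algebra it generates determines a measure.
  have key : ∀ κ : Measure ℝ, (∀ᵐ t ∂κ, 0 ≤ t) →
      (κ.map Real.toNNReal).map ((↑) : NNReal → ℝ) = κ := by
    intro κ hκ
    rw [Measure.map_map (by fun_prop) (by fun_prop)]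
    conv_rhs => rw [← Measure.map_id (μ := κ)]
    refine Measure.map_congr ?_
    filter_upwards [hκ] with t ht
    simp [ht]
  rw [← key μ hμ, ← key ν hν]
  congr 1
  have : IsProbabilityMeasure (μ.map Real.toNNReal) :=
    Measure.isProbabilityMeasure_map (by fun_prop)
  have : IsProbabilityMeasure (ν.map Real.toNNReal) :=
    Measure.isProbabilityMeasure_map (by fun_prop)
  let e : BoundedContinuousFunction NNReal ℝ :=
    BoundedContinuousFunction.ofNormedAddCommGroup (fun t : NNReal => Real.exp (-(t : ℝ)))
      (by fun_prop) 1 (fun t => by simp)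
  let A : StarSubalgebra ℝ (BoundedContinuousFunction NNReal ℝ) :=
    { toSubalgebra := Algebra.adjoin ℝ {e}
      star_mem' := by
        intro f hf
        have : star f = f := by ext x; simp
        rwa [this] }
  refine ext_of_forall_mem_subalgebra_integral_eq_of_polish (𝕜 := ℝ) (A := A) ?_ ?_
  · intro x y hxy
    refine ⟨e, ⟨e.toContinuousMap, ?_, rfl⟩, ?_⟩
    · exact ⟨e, Algebra.subset_adjoin rfl, rfl⟩
    · intro hc
      apply hxy
      have : Real.exp (-(x : ℝ)) = Real.exp (-(y : ℝ)) := hc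
      simpa using this
  · intro g hg
    have hg' : g ∈ Algebra.adjoin ℝ {e} := hg
    rw [Algebra.adjoin_singleton_eq_range_aeval] at hg'
    obtain ⟨p, rfl⟩ := hg'
    -- A polynomial in `exp (-t)` is a combination of the `exp (-i t)`, so the transform at natural
    -- numbers suffices.
    have hev : ∀ x, (Polynomial.aeval e p) x = ∑ i ∈ p.support, p.coeff i * Real.exp (-(i : ℝ) * x) := by
      intro x
      have h1 : ∀ q : Polynomial ℝ, (Polynomial.aeval e q) x = q.eval (e x) := by
        intro q
        induction q using Polynomial.induction_on' with
        | add p q hp hq => simp [hp, hq]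
        | monomial n a =>
          simp [Polynomial.aeval_monomial, BoundedContinuousFunction.algebraMap_apply]
      rw [h1, Polynomial.eval_eq_sum, Polynomial.sum]
      refine Finset.sum_congr rfl fun i _ => ?_
      congr 1
      change Real.exp (-(x : ℝ)) ^ i = _
      rw [← Real.exp_nat_mul]; congr 1; ring
    have hint : ∀ κ : Measure ℝ, IsProbabilityMeasure κ → (∀ᵐ t ∂κ, 0 ≤ t) →
        ∫ x, (Polynomial.aeval e p) x ∂(κ.map Real.toNNReal)
          = ∑ i ∈ p.support, p.coeff i * ∫ t, Real.exp (-(i : ℝ) * t) ∂κ := by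
      intro κ _ hκ
      rw [integral_map (by fun_prop) (by exact (BoundedContinuousFunction.continuous _).aestronglyMeasurable)]
      simp_rw [hev]
      rw [integral_finsetSum]
      · refine Finset.sum_congr rfl fun i _ => ?_
        rw [integral_const_mul]
        congr 1
        refine integral_congr_ae ?_
        filter_upwards [hκ] with t ht
        simp [ht]
      · intro i _
        refine Integrable.const_mul ?_ _
        refine Integrable.of_bound (by fun_prop) 1 (ae_of_all _ fun t => ?_)
        simp only [Real.norm_eq_abs, Real.abs_exp, Real.exp_le_one_iff]
        have : 0 ≤ (i : ℝ) * (Real.toNNReal t : ℝ) := by positivity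
        linarith
    refine (hint μ inferInstance hμ).trans (Eq.trans ?_ (hint ν inferInstance hν).symm)
    simp_rw [h]

/-- Integrability of the Laplace kernel against a probability measure on `[0, ∞)`. -/
theorem integrable_exp_neg_mul {μ : Measure ℝ} [IsProbabilityMeasure μ] (hμ : ∀ᵐ t ∂μ, 0 ≤ t)
    {s : ℝ} (hs : 0 ≤ s) : Integrable (fun t => Real.exp (-s * t)) μ := by
  refine Integrable.of_bound (by fun_prop) 1 ?_
  filter_upwards [hμ] with t ht
  simp only [Real.norm_eq_abs, Real.abs_exp, Real.exp_le_one_iff]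
  nlinarith [mul_nonneg hs ht]

/-- Chebyshev-type tail bound through the Laplace transform. -/
theorem measureReal_norm_gt_le_laplace {μ : Measure ℝ} [IsProbabilityMeasure μ]
    (hμ : ∀ᵐ t ∂μ, 0 ≤ t) {s r : ℝ} (hs : 0 < s) (hr : 1 ≤ s * r) :
    μ.real {x | r < ‖x‖} ≤ 2 * (1 - ∫ t, Real.exp (-s * t) ∂μ) := by
  have h1 : ∫ t, (1 - Real.exp (-s * t)) ∂μ = 1 - ∫ t, Real.exp (-s * t) ∂μ := by
    rw [integral_sub (integrable_const _) (integrable_exp_neg_mul hμ hs.le)]; simp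
  rw [← h1]
  have hm : MeasurableSet {x : ℝ | r < ‖x‖} := measurableSet_lt (by fun_prop) (by fun_prop)
  rw [← integral_indicator_one hm, ← integral_const_mul]
  refine integral_mono_ae ?_ ?_ ?_
  · exact (integrable_const (1 : ℝ)).indicator hm
  · exact ((integrable_const _).sub (integrable_exp_neg_mul hμ hs.le)).const_mul _
  · filter_upwards [hμ] with t ht
    have he : Real.exp (-s * t) ≤ 1 := by
      rw [Real.exp_le_one_iff]; nlinarith [mul_nonneg hs.le ht]
    by_cases hx : r < ‖t‖
    · rw [Set.indicator_of_mem (by exact hx)]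
      rw [Real.norm_of_nonneg ht] at hx
      have h2 : Real.exp (-s * t) ≤ Real.exp (-1) := by
        apply Real.exp_le_exp.2; nlinarith
      -- On the tail `s t ≥ 1`, so `1 - exp (-s t)` exceeds `1 / 2`; this is the source of the
      -- factor 2.
      have h3 : Real.exp (-1) < 1 / 2 := by
        have := Real.exp_neg_one_lt_d9; linarith
      simp only [Pi.one_apply]; linarith
    · rw [Set.indicator_of_notMem (by exact hx)]
      linarith

open Topology in
/-- Continuity theorem for Laplace transforms of probability measures on `[0, ∞)`. -/
theorem exists_tendsto_of_laplace_tendsto (μ : ℕ → ProbabilityMeasure ℝ) (φ : ℝ → ℝ)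
    (hμ : ∀ n, ∀ᵐ t ∂(μ n : Measure ℝ), 0 ≤ t)
    (hφ : ∀ s, 0 < s → Tendsto (fun n => ∫ t, Real.exp (-s * t) ∂(μ n : Measure ℝ)) atTop (𝓝 (φ s)))
    (hφ0 : Tendsto φ (𝓝[>] 0) (𝓝 1)) :
    ∃ ν : ProbabilityMeasure ℝ, (∀ᵐ t ∂(ν : Measure ℝ), 0 ≤ t) ∧
      (∀ s, 0 < s → ∫ t, Real.exp (-s * t) ∂(ν : Measure ℝ) = φ s) ∧ Tendsto μ atTop (𝓝 ν) := by
  have tight : IsTightMeasureSet (Set.range fun n => (μ n : Measure ℝ)) := by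
    apply isTightMeasureSet_range_of_tendsto_limsup_measure_norm_gt
    rw [ENNReal.tendsto_nhds_zero]
    intro ε hε
    obtain ⟨δ, hδ0, hδ⟩ : ∃ δ : ℝ, 0 < δ ∧ ENNReal.ofReal δ ≤ ε := by
      rcases eq_or_ne ε ⊤ with rfl | h
      · exact ⟨1, one_pos, le_top⟩
      · exact ⟨ε.toReal, ENNReal.toReal_pos hε.ne' h, by rw [ENNReal.ofReal_toReal h]⟩
    have hev : ∀ᶠ s in 𝓝[>] (0 : ℝ), 1 - δ / 4 < φ s := hφ0.eventually_const_lt (by linarith)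
    obtain ⟨s, hs1, hs0⟩ := (hev.and self_mem_nhdsWithin).exists
    have hs0 : 0 < s := hs0
    filter_upwards [eventually_ge_atTop (1 / s)] with r hr
    have hr1 : 1 ≤ s * r := by rw [div_le_iff₀ hs0] at hr; linarith
    refine limsup_le_of_le (by isBoundedDefault) ?_
    filter_upwards [(hφ s hs0).eventually_const_lt hs1] with n hn
    refine le_trans ?_ hδ
    rw [← ENNReal.ofReal_toReal (measure_ne_top (μ n : Measure ℝ) _)]
    apply ENNReal.ofReal_le_ofReal
    have := measureReal_norm_gt_le_laplace (hμ n) hs0 hr1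
    rw [measureReal_def] at this
    linarith
  have hcomp : IsCompact (closure (Set.range μ)) := by
    apply isCompact_closure_of_isTightMeasureSet
    convert tight using 1
    ext κ; simp
  -- Stated for an arbitrary filter because it is applied to ultrafilters: every limit point has
  -- transform `φ`, hence they all coincide.
  have hclus : ∀ (F : Filter ℕ) (ν : ProbabilityMeasure ℝ), F.NeBot → F ≤ atTop → Tendsto μ F (𝓝 ν) →
      (∀ᵐ t ∂(ν : Measure ℝ), 0 ≤ t) ∧
      (∀ s, 0 < s → ∫ t, Real.exp (-s * t) ∂(ν : Measure ℝ) = φ s) := by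
    intro F ν _ hF hν
    have hpos : ∀ᵐ t ∂(ν : Measure ℝ), 0 ≤ t := by
      have h1 := ProbabilityMeasure.le_liminf_measure_open_of_tendsto hν (isOpen_Iio (a := (0 : ℝ)))
      have h2 : ∀ n, (μ n : Measure ℝ) (Set.Iio 0) = 0 := by
        intro n
        have := hμ n
        rw [ae_iff] at this
        simpa [not_le, Set.Iio] using this
      simp only [h2] at h1
      rw [ae_iff]
      simpa [not_le, Set.Iio] using h1
    refine ⟨hpos, fun s hs => ?_⟩
    -- The truncation `max t 0` makes the kernel bounded on the whole line without changing it on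
    -- the supports.
    have h3 := (ProbabilityMeasure.tendsto_iff_forall_integral_tendsto.1 hν)
      (BoundedContinuousFunction.ofNormedAddCommGroup (fun t : ℝ => Real.exp (-s * max t 0))
      (by fun_prop) 1 (fun t => by
        simp only [Real.norm_eq_abs, Real.abs_exp, Real.exp_le_one_iff]
        nlinarith [mul_nonneg hs.le (le_max_right t 0)]))
    have h4 : ∀ κ : Measure ℝ, (∀ᵐ t ∂κ, 0 ≤ t) →
        ∫ t, Real.exp (-s * max t 0) ∂κ = ∫ t, Real.exp (-s * t) ∂κ := by
      intro κ hκ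
      refine integral_congr_ae ?_
      filter_upwards [hκ] with t ht
      simp [ht]
    simp only [BoundedContinuousFunction.coe_ofNormedAddCommGroup] at h3
    rw [h4 _ hpos] at h3
    simp_rw [fun n => h4 _ (hμ n)] at h3
    exact tendsto_nhds_unique h3 ((hφ s hs).mono_left hF)
  have huniq : ∀ ν ν' : ProbabilityMeasure ℝ,
      (∀ᵐ t ∂(ν : Measure ℝ), 0 ≤ t) → (∀ᵐ t ∂(ν' : Measure ℝ), 0 ≤ t) →
      (∀ s, 0 < s → ∫ t, Real.exp (-s * t) ∂(ν : Measure ℝ) = φ s) →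
      (∀ s, 0 < s → ∫ t, Real.exp (-s * t) ∂(ν' : Measure ℝ) = φ s) → ν = ν' := by
    intro ν ν' h1 h2 h3 h4
    apply Subtype.ext
    have := ν.2
    have := ν'.2
    refine laplace_ext (μ := (ν : Measure ℝ)) (ν := (ν' : Measure ℝ)) h1 h2 fun n => ?_
    rcases Nat.eq_zero_or_pos n with rfl | hn
    · simp
    · rw [h3 n (by exact_mod_cast hn), h4 n (by exact_mod_cast hn)]
  obtain ⟨ν, -, hν⟩ := hcomp.exists_mapClusterPt (f := atTop) (u := μ)
    (by
      rw [le_principal_iff, mem_map]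
      filter_upwards with n using subset_closure ⟨n, rfl⟩)
  rw [mapClusterPt_iff_ultrafilter] at hν
  obtain ⟨U, hU, hUν⟩ := hν
  obtain ⟨hp, hl⟩ := hclus U ν inferInstance hU hUν
  refine ⟨ν, hp, hl, ?_⟩
  refine (tendsto_iff_ultrafilter _ _ _).2 fun V hV => ?_
  obtain ⟨ν', -, hν'⟩ := hcomp.ultrafilter_le_nhds (V.map μ)
    (le_trans (by simp) (monotone_principal subset_closure))
  have hV' : Tendsto μ V (𝓝 ν') := hν'
  obtain ⟨hp', hl'⟩ := hclus V ν' inferInstance hV hV'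
  rwa [huniq ν ν' hp hp' hl hl']

/-! ### Scaled Abel sums and a Karamata-type Tauberian theorem -/

theorem summable_exp_neg_mul_nat_div {l : ℝ} (hl : 0 < l) {m : ℕ} (hm : 0 < m) :
    Summable (fun n : ℕ => Real.exp (-(l * (n / m)))) := by
  have hm' : (0 : ℝ) < m := by exact_mod_cast hm
  have : (fun n : ℕ => Real.exp (-(l * (n / m)))) = fun n : ℕ => Real.exp (-(l / m)) ^ n := by
    ext n; rw [← Real.exp_nat_mul]; congr 1; ring
  rw [this]
  refine summable_geometric_of_lt_one (Real.exp_pos _).le ?_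
  rw [Real.exp_lt_one_iff]
  have : 0 < l / m := by positivity
  linarith

theorem tsum_exp_neg_mul_nat_div {l : ℝ} (hl : 0 < l) {m : ℕ} (hm : 0 < m) :
    ∑' n : ℕ, Real.exp (-(l * (n / m))) = (1 - Real.exp (-(l / m)))⁻¹ := by
  have hm' : (0 : ℝ) < m := by exact_mod_cast hm
  have : (fun n : ℕ => Real.exp (-(l * (n / m)))) = fun n : ℕ => Real.exp (-(l / m)) ^ n := by
    ext n; rw [← Real.exp_nat_mul]; congr 1; ring
  rw [this]
  refine tsum_geometric_of_lt_one (Real.exp_pos _).le ?_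
  rw [Real.exp_lt_one_iff]
  have : 0 < l / m := by positivity
  linarith

open Topology in
theorem tendsto_mul_one_sub_exp_neg_div_of_atTop (l : ℝ) {L : ℕ → ℝ} (hL : Tendsto L atTop atTop) :
    Tendsto (fun m : ℕ => L m * (1 - Real.exp (-(l / L m)))) atTop (𝓝 l) := by
  have hd : HasDerivAt (fun x : ℝ => 1 - Real.exp (-(l * x))) l 0 := by
    have h1 : HasDerivAt (fun x : ℝ => -(l * x)) (-(l * 1)) 0 := ((hasDerivAt_id 0).const_mul l).neg
    have := (h1.exp).const_sub 1
    simpa using this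
  have h2 := hd.tendsto_slope_zero_right
  have h3 : Tendsto (fun m : ℕ => (L m)⁻¹) atTop (𝓝[>] 0) :=
    tendsto_inv_atTop_nhdsGT_zero.comp hL
  have h4 := h2.comp h3
  refine h4.congr fun m => ?_
  simp [div_eq_mul_inv]

open Topology in
theorem tendsto_mul_one_sub_exp_neg_div (l : ℝ) :
    Tendsto (fun m : ℕ => (m : ℝ) * (1 - Real.exp (-(l / m)))) atTop (𝓝 l) :=
  tendsto_mul_one_sub_exp_neg_div_of_atTop l tendsto_natCast_atTop_atTop

open Topology in
theorem tendsto_riemann_exp {l : ℝ} (hl : 0 < l) :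
    Tendsto (fun m : ℕ => (m : ℝ)⁻¹ * ∑' n : ℕ, Real.exp (-(l * (n / m)))) atTop (𝓝 l⁻¹) := by
  refine ((tendsto_mul_one_sub_exp_neg_div l).inv₀ hl.ne').congr' ?_
  filter_upwards [eventually_gt_atTop 0] with m hm
  rw [tsum_exp_neg_mul_nat_div hl hm, mul_inv]

open Topology in
/-- Passage from exponentials to continuous functions of `exp (-t)` in a scaled Abel sum. -/
theorem tendsto_abel_sum_continuous {h : ℕ → ℕ → ℝ} (h0 : ∀ m n, 0 ≤ h m n)
    (h1 : ∀ m n, h m n ≤ 1) {ψ : ℝ → ℝ} {l : ℝ} (hl : 0 < l)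
    (hψ : IntegrableOn (fun t => Real.exp (-(l * t)) * ψ t) (Set.Ioi 0))
    (hlim : ∀ k : ℕ, Tendsto
      (fun m : ℕ => (m : ℝ)⁻¹ * ∑' n : ℕ, Real.exp (-((l + k) * (n / m))) * h m n) atTop
      (𝓝 (∫ t in Set.Ioi 0, Real.exp (-((l + k) * t)) * ψ t)))
    {g : ℝ → ℝ} (hg : Continuous g) :
    Tendsto (fun m : ℕ => (m : ℝ)⁻¹ *
        ∑' n : ℕ, Real.exp (-(l * (n / m))) * g (Real.exp (-(n / m))) * h m n) atTop
      (𝓝 (∫ t in Set.Ioi 0, Real.exp (-(l * t)) * g (Real.exp (-t)) * ψ t)) := by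
  have hmem : ∀ t : ℝ, 0 ≤ t → Real.exp (-t) ∈ Set.Icc (0 : ℝ) 1 := fun t ht =>
    ⟨(Real.exp_pos _).le, by rw [Real.exp_le_one_iff]; linarith⟩
  have hmem' : ∀ n m : ℕ, Real.exp (-((n : ℝ) / m)) ∈ Set.Icc (0 : ℝ) 1 := fun n m =>
    hmem _ (by positivity)
  have hsum : ∀ {g : ℝ → ℝ}, Continuous g → ∀ {m : ℕ}, 0 < m → Summable fun n : ℕ =>
      Real.exp (-(l * (n / m))) * g (Real.exp (-(n / m))) * h m n := by
    intro g hg m hm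
    obtain ⟨B, hB⟩ := isCompact_Icc.exists_bound_of_continuousOn (hg.continuousOn (s := Set.Icc 0 1))
    refine Summable.of_norm_bounded ((summable_exp_neg_mul_nat_div hl hm).mul_right B) fun n => ?_
    rw [norm_mul, norm_mul, Real.norm_of_nonneg (Real.exp_pos _).le, Real.norm_of_nonneg (h0 m n)]
    have h2 := hB _ (hmem' n m)
    have h3 : 0 ≤ Real.exp (-(l * (n / m))) * ‖g (Real.exp (-(n / m)))‖ := by positivity
    have h4 := mul_le_mul_of_nonneg_left (h1 m n) h3
    have h5 := mul_le_mul_of_nonneg_left h2 (Real.exp_pos (-(l * ((n : ℝ) / m)))).le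
    linarith
  have hint : ∀ {g : ℝ → ℝ}, Continuous g →
      IntegrableOn (fun t => Real.exp (-(l * t)) * g (Real.exp (-t)) * ψ t) (Set.Ioi 0) := by
    intro g hg
    obtain ⟨B, hB⟩ := isCompact_Icc.exists_bound_of_continuousOn (hg.continuousOn (s := Set.Icc 0 1))
    have : IntegrableOn (fun t => g (Real.exp (-t)) * (Real.exp (-(l * t)) * ψ t)) (Set.Ioi 0) := by
      refine Integrable.bdd_mul (c := B) hψ (by fun_prop) ?_
      filter_upwards [ae_restrict_mem measurableSet_Ioi] with t ht
      exact hB _ (hmem t (le_of_lt ht))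
    refine this.congr (ae_of_all _ fun t => ?_)
    ring
  -- Multiplying by the monomial `uᵏ` at `u = exp (-t)` shifts `l` to `l + k`, which is why `hlim`
  -- is assumed for every `k`.
  have hpoly : ∀ p : Polynomial ℝ, Tendsto (fun m : ℕ => (m : ℝ)⁻¹ *
        ∑' n : ℕ, Real.exp (-(l * (n / m))) * p.eval (Real.exp (-(n / m))) * h m n) atTop
      (𝓝 (∫ t in Set.Ioi 0, Real.exp (-(l * t)) * p.eval (Real.exp (-t)) * ψ t)) := by
    intro p
    induction p using Polynomial.induction_on' with
    | add p q hp hq =>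
      have := hp.add hq
      rw [← integral_add (hint p.continuous) (hint q.continuous)] at this
      have e : ∀ t, Real.exp (-(l * t)) * Polynomial.eval (Real.exp (-t)) p * ψ t +
          Real.exp (-(l * t)) * Polynomial.eval (Real.exp (-t)) q * ψ t =
          Real.exp (-(l * t)) * Polynomial.eval (Real.exp (-t)) (p + q) * ψ t := by
        intro t; rw [Polynomial.eval_add]; ring
      simp_rw [e] at this
      refine this.congr' ?_
      filter_upwards [eventually_gt_atTop 0] with m hm
      rw [← mul_add, ← (hsum p.continuous hm).tsum_add (hsum q.continuous hm)]
      congr 2; ext n; rw [Polynomial.eval_add]; ring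
    | monomial k c =>
      have := (hlim k).const_mul c
      rw [← integral_const_mul] at this
      have e : ∀ t, Real.exp (-(l * t)) * Polynomial.eval (Real.exp (-t)) (Polynomial.monomial k c)
          = c * Real.exp (-((l + k) * t)) := by
        intro t
        rw [Polynomial.eval_monomial, ← Real.exp_nat_mul, mul_left_comm, ← Real.exp_add]
        congr 2; ring
      simp_rw [e]
      refine (this.congr fun m => ?_).trans (le_of_eq ?_)
      · rw [mul_left_comm, ← tsum_mul_left]; simp_rw [mul_assoc]
      · simp_rw [mul_assoc]
  set D := ∫ t in Set.Ioi 0, |Real.exp (-(l * t)) * ψ t| with hD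
  have hD0 : 0 ≤ D := integral_nonneg fun t => abs_nonneg _
  rw [Metric.tendsto_atTop]
  intro ε hε
  -- The Weierstrass error is paid twice: in the sums, whose total weight is eventually below `l⁻¹ +
  -- 1`, and in the integral, of weight `D`. Each gets `ε / 3`.
  set η := ε / (3 * (l⁻¹ + 1 + D)) with hη
  have hη0 : 0 < η := by positivity
  have hηl : η * (l⁻¹ + 1) ≤ ε / 3 := by
    rw [hη, div_mul_eq_mul_div, div_le_div_iff₀ (by positivity) (by positivity)]
    nlinarith [mul_nonneg hε.le hD0]
  have hηD : η * D ≤ ε / 3 := by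
    rw [hη, div_mul_eq_mul_div, div_le_div_iff₀ (by positivity) (by positivity)]
    have : 0 < l⁻¹ + 1 := by positivity
    nlinarith [mul_pos hε this]
  obtain ⟨p, hp⟩ := exists_polynomial_near_of_continuousOn 0 1 g hg.continuousOn η hη0
  have e1 : ∀ᶠ m : ℕ in atTop, (m : ℝ)⁻¹ * ∑' n : ℕ, Real.exp (-(l * (n / m))) < l⁻¹ + 1 :=
    (tendsto_riemann_exp hl).eventually_lt_const (by linarith)
  have e2 := (Metric.tendsto_nhds.1 (hpoly p)) (ε / 3) (by positivity)
  have hI : |(∫ t in Set.Ioi 0, Real.exp (-(l * t)) * p.eval (Real.exp (-t)) * ψ t) -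
      ∫ t in Set.Ioi 0, Real.exp (-(l * t)) * g (Real.exp (-t)) * ψ t| ≤ η * D := by
    rw [← integral_sub (hint p.continuous) (hint hg), hD, ← integral_const_mul]
    rw [← Real.norm_eq_abs]
    refine norm_integral_le_of_norm_le (hψ.abs.const_mul _) ?_
    filter_upwards [ae_restrict_mem measurableSet_Ioi] with t ht
    have : Real.exp (-(l * t)) * p.eval (Real.exp (-t)) * ψ t -
        Real.exp (-(l * t)) * g (Real.exp (-t)) * ψ t =
        (p.eval (Real.exp (-t)) - g (Real.exp (-t))) * (Real.exp (-(l * t)) * ψ t) := by ring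
    rw [this, norm_mul]
    exact mul_le_mul_of_nonneg_right (hp _ (hmem t (le_of_lt ht))).le (norm_nonneg _)
  obtain ⟨N, hN⟩ := eventually_atTop.1 ((e1.and e2).and (eventually_gt_atTop 0))
  refine ⟨N, fun m hm => ?_⟩
  obtain ⟨⟨a1, a2⟩, hm0⟩ := hN m hm
  have hJ : |(m : ℝ)⁻¹ * (∑' n : ℕ, Real.exp (-(l * (n / m))) * g (Real.exp (-(n / m))) * h m n) -
      (m : ℝ)⁻¹ * ∑' n : ℕ, Real.exp (-(l * (n / m))) * p.eval (Real.exp (-(n / m))) * h m n|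
      ≤ η * ((m : ℝ)⁻¹ * ∑' n : ℕ, Real.exp (-(l * (n / m)))) := by
    rw [← mul_sub, ← (hsum hg hm0).tsum_sub (hsum p.continuous hm0), abs_mul,
      abs_of_nonneg (by positivity : (0 : ℝ) ≤ (m : ℝ)⁻¹), mul_left_comm]
    refine mul_le_mul_of_nonneg_left ?_ (by positivity)
    rw [← tsum_mul_left, ← Real.norm_eq_abs]
    refine tsum_of_norm_bounded ((summable_exp_neg_mul_nat_div hl hm0).mul_left η).hasSum fun n => ?_
    have : Real.exp (-(l * (n / m))) * g (Real.exp (-(n / m))) * h m n -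
        Real.exp (-(l * (n / m))) * p.eval (Real.exp (-(n / m))) * h m n =
        -((p.eval (Real.exp (-(n / m))) - g (Real.exp (-(n / m)))) *
          Real.exp (-(l * (n / m))) * h m n) := by ring
    rw [this, norm_neg, norm_mul, norm_mul, Real.norm_of_nonneg (Real.exp_pos _).le,
      Real.norm_of_nonneg (h0 m n)]
    have h2 := (hp _ (hmem' n m)).le
    have h3 : 0 ≤ ‖p.eval (Real.exp (-(n / m))) - g (Real.exp (-(n / m)))‖ *
      Real.exp (-(l * (n / m))) := by positivity
    have h4 := mul_le_mul_of_nonneg_left (h1 m n) h3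
    have h5 := mul_le_mul_of_nonneg_right h2 (Real.exp_pos (-(l * ((n : ℝ) / m)))).le
    rw [Real.norm_eq_abs] at *
    linarith
  rw [Real.dist_eq] at a2 ⊢
  have hJ2 : η * ((m : ℝ)⁻¹ * ∑' n : ℕ, Real.exp (-(l * (n / m)))) < ε / 3 :=
    lt_of_lt_of_le (mul_lt_mul_of_pos_left a1 hη0) hηl
  rw [abs_lt] at a2 ⊢
  rw [abs_le] at hJ hI
  constructor <;> linarith [hJ.1, hJ.2, hI.1, hI.2, a2.1, a2.2]

/-- A continuous bump supported on `[u₁, u₂]`. -/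
noncomputable def quadraticBump (u₁ u₂ u : ℝ) : ℝ := max 0 ((u₂ - u) * (u - u₁))

theorem continuous_quadraticBump (u₁ u₂ : ℝ) : Continuous (quadraticBump u₁ u₂) := by
  unfold quadraticBump; fun_prop

theorem quadraticBump_nonneg (u₁ u₂ u : ℝ) : 0 ≤ quadraticBump u₁ u₂ u := le_max_left _ _

theorem quadraticBump_pos {u₁ u₂ u : ℝ} (h₁ : u₁ < u) (h₂ : u < u₂) : 0 < quadraticBump u₁ u₂ u :=
  lt_max_of_lt_right (mul_pos (by linarith) (by linarith))

theorem mem_Icc_of_quadraticBump_ne_zero {u₁ u₂ u : ℝ} (h : u₁ ≤ u₂)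
    (hu : quadraticBump u₁ u₂ u ≠ 0) : u ∈ Set.Icc u₁ u₂ := by
  by_contra hc
  apply hu
  apply max_eq_left
  rw [Set.mem_Icc, not_and_or, not_le, not_le] at hc
  rcases hc with hc | hc
  · exact mul_nonpos_of_nonneg_of_nonpos (by linarith) (by linarith)
  · exact mul_nonpos_of_nonpos_of_nonneg (by linarith) (by linarith)

open Topology in
/-- Karamata-type Tauberian theorem for a family of antitone sequences. -/
theorem tendsto_diag_of_abel_sum {h : ℕ → ℕ → ℝ} (hanti : ∀ m, Antitone (h m))
    (h0 : ∀ m n, 0 ≤ h m n) (h1 : ∀ m n, h m n ≤ 1) {ψ : ℝ → ℝ} {l : ℝ} (hl : 0 < l)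
    (hψ : IntegrableOn (fun t => Real.exp (-(l * t)) * ψ t) (Set.Ioi 0))
    (hψc : ContinuousAt ψ 1)
    (hlim : ∀ k : ℕ, Tendsto
      (fun m : ℕ => (m : ℝ)⁻¹ * ∑' n : ℕ, Real.exp (-((l + k) * (n / m))) * h m n) atTop
      (𝓝 (∫ t in Set.Ioi 0, Real.exp (-((l + k) * t)) * ψ t))) :
    Tendsto (fun m => h m m) atTop (𝓝 (ψ 1)) := by
  have hexp : ∀ c : ℝ, 0 < c → IntegrableOn (fun t => Real.exp (-(c * t))) (Set.Ioi 0) := by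
    intro c hc
    simpa [neg_mul] using exp_neg_integrableOn_Ioi 0 hc
  have hone : ∀ k : ℕ, Tendsto
      (fun m : ℕ => (m : ℝ)⁻¹ * ∑' n : ℕ, Real.exp (-((l + k) * (n / m))) * 1) atTop
      (𝓝 (∫ t in Set.Ioi (0 : ℝ), Real.exp (-((l + k) * t)) * 1)) := by
    intro k
    have hlk : 0 < l + k := by positivity
    have := tendsto_riemann_exp hlk
    have e : ∫ t in Set.Ioi (0 : ℝ), Real.exp (-((l + k) * t)) * 1 = (l + k)⁻¹ := by
      have := integral_exp_mul_Ioi (a := -(l + k)) (by linarith) 0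
      simp only [neg_mul] at this
      simp only [mul_one]
      rw [this, mul_zero, neg_zero, Real.exp_zero, neg_div_neg_eq, one_div]
    rw [e]
    simpa using this
  -- limits of the sums weighted by a bump in `t ∈ [t₁, t₂]`
  have hb : ∀ t₁ t₂ : ℝ, 0 ≤ t₁ → t₁ < t₂ → ∀ (A B : ℝ), (∀ t ∈ Set.Icc t₁ t₂, A ≤ ψ t ∧ ψ t ≤ B) →
      ∃ (u v : ℕ → ℝ) (u' v' : ℝ), Tendsto u atTop (𝓝 u') ∧ Tendsto v atTop (𝓝 v') ∧
        0 < v' ∧ A * v' ≤ u' ∧ u' ≤ B * v' ∧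
        ∀ m : ℕ, 0 < m → (∀ c, (∀ n : ℕ, t₁ ≤ n / (m : ℝ) → h m n ≤ c) → u m ≤ c * v m) ∧
          (∀ c, (∀ n : ℕ, n / (m : ℝ) ≤ t₂ → c ≤ h m n) → c * v m ≤ u m) := by
    intro t₁ t₂ ht₁ ht A B hAB
    have hle : Real.exp (-t₂) ≤ Real.exp (-t₁) := Real.exp_le_exp.2 (by linarith)
    -- In the variable `u = exp (-t)` the window `[t₁, t₂]` becomes `[exp (-t₂), exp (-t₁)]`. A
    -- continuous bump replaces the indicator, so `tendsto_abel_sum_continuous` applies both to `h`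
    -- and to the constant 1; the quotient is a weighted mean of `h` over the window.
    set g := quadraticBump (Real.exp (-t₂)) (Real.exp (-t₁)) with hgdef
    have hgc : Continuous g := continuous_quadraticBump _ _
    have hg0 : ∀ u, 0 ≤ g u := quadraticBump_nonneg _ _
    have hgs : ∀ t, g (Real.exp (-t)) ≠ 0 → t ∈ Set.Icc t₁ t₂ := by
      intro t hgt
      have := mem_Icc_of_quadraticBump_ne_zero hle hgt
      rw [Set.mem_Icc, Real.exp_le_exp, Real.exp_le_exp] at this
      exact ⟨by linarith [this.2], by linarith [this.1]⟩
    have hgB : ∃ K, ∀ t : ℝ, 0 ≤ t → g (Real.exp (-t)) ≤ K := by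
      obtain ⟨K, hK⟩ := isCompact_Icc.exists_bound_of_continuousOn
        (hgc.continuousOn (s := Set.Icc 0 1))
      exact ⟨K, fun t ht => (le_abs_self _).trans (hK _ ⟨(Real.exp_pos _).le, by
        rw [Real.exp_le_one_iff]; linarith⟩)⟩
    obtain ⟨K, hK⟩ := hgB
    have hmeas1 : IntegrableOn (fun t => Real.exp (-(l * t)) * g (Real.exp (-t)) * 1) (Set.Ioi 0) := by
      have : IntegrableOn (fun t => g (Real.exp (-t)) * Real.exp (-(l * t))) (Set.Ioi 0) := by
        refine Integrable.bdd_mul (c := K) (hexp l hl) (by fun_prop) ?_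
        filter_upwards [ae_restrict_mem measurableSet_Ioi] with t ht
        rw [Real.norm_of_nonneg (hg0 _)]
        exact hK _ (le_of_lt ht)
      refine this.congr (ae_of_all _ fun t => ?_)
      ring
    have hmeasψ : IntegrableOn (fun t => Real.exp (-(l * t)) * g (Real.exp (-t)) * ψ t)
        (Set.Ioi 0) := by
      have : IntegrableOn (fun t => g (Real.exp (-t)) * (Real.exp (-(l * t)) * ψ t)) (Set.Ioi 0) := by
        refine Integrable.bdd_mul (c := K) hψ (by fun_prop) ?_
        filter_upwards [ae_restrict_mem measurableSet_Ioi] with t ht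
        rw [Real.norm_of_nonneg (hg0 _)]
        exact hK _ (le_of_lt ht)
      refine this.congr (ae_of_all _ fun t => ?_)
      ring
    have hw0 : ∀ t, 0 ≤ Real.exp (-(l * t)) * g (Real.exp (-t)) := fun t =>
      mul_nonneg (Real.exp_pos _).le (hg0 _)
    refine ⟨_, _, _, _, tendsto_abel_sum_continuous h0 h1 hl hψ hlim hgc,
      tendsto_abel_sum_continuous (h := fun _ _ => 1) (ψ := fun _ => 1) (fun _ _ => zero_le_one)
        (fun _ _ => le_rfl) hl (by simpa using hexp l hl) hone hgc, ?_, ?_, ?_, ?_⟩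
    · rw [setIntegral_pos_iff_support_of_nonneg_ae (ae_of_all _ fun t => by simpa using hw0 t) hmeas1]
      have hsub : Set.Ioo t₁ t₂ ⊆ (Function.support fun t =>
          Real.exp (-(l * t)) * g (Real.exp (-t)) * 1) ∩ Set.Ioi 0 := by
        intro t ht
        refine ⟨?_, lt_of_le_of_lt ht₁ ht.1⟩
        have : 0 < g (Real.exp (-t)) := quadraticBump_pos (Real.exp_lt_exp.2 (by linarith [ht.2]))
          (Real.exp_lt_exp.2 (by linarith [ht.1]))
        rw [Function.mem_support]
        positivity
      refine lt_of_lt_of_le ?_ (measure_mono hsub)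
      simp [ht]
    · rw [← integral_const_mul]
      refine integral_mono (hmeas1.const_mul _) hmeasψ fun t => ?_
      by_cases hz : g (Real.exp (-t)) = 0
      · simp [hz]
      · have := mul_le_mul_of_nonneg_right (hAB t (hgs t hz)).1 (hw0 t)
        simp only; linarith
    · rw [← integral_const_mul]
      refine integral_mono hmeasψ (hmeas1.const_mul _) fun t => ?_
      by_cases hz : g (Real.exp (-t)) = 0
      · simp [hz]
      · have := mul_le_mul_of_nonneg_right (hAB t (hgs t hz)).2 (hw0 t)
        simp only; linarith
    · intro m hm
      have hs : ∀ f : ℕ → ℝ, (∀ n, 0 ≤ f n) → (∀ n, f n ≤ 1) → Summable fun n : ℕ =>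
          Real.exp (-(l * (n / m))) * g (Real.exp (-(n / m))) * f n := by
        intro f hf0 hf1
        refine Summable.of_nonneg_of_le (fun n => mul_nonneg (hw0 _) (hf0 n)) (fun n => ?_)
          ((summable_exp_neg_mul_nat_div hl hm).mul_right K)
        have h2 := mul_le_mul_of_nonneg_left (hf1 n) (hw0 (n / m))
        have h3 := mul_le_mul_of_nonneg_left (hK (n / m) (by positivity))
          (Real.exp_pos (-(l * ((n : ℝ) / m)))).le
        linarith
      have s1 := hs (h m) (h0 m) (h1 m)
      have s2 := hs (fun _ => 1) (fun _ => zero_le_one) (fun _ => le_rfl)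
      refine ⟨fun c hc => ?_, fun c hc => ?_⟩
      · rw [mul_left_comm, ← tsum_mul_left (a := c)]
        refine mul_le_mul_of_nonneg_left (s1.tsum_le_tsum (fun n => ?_) (s2.mul_left c))
          (by positivity)
        by_cases hz : g (Real.exp (-(n / m))) = 0
        · simp [hz]
        · have := mul_le_mul_of_nonneg_left (hc n (hgs _ hz).1) (hw0 (n / m))
          linarith
      · rw [mul_left_comm, ← tsum_mul_left (a := c)]
        refine mul_le_mul_of_nonneg_left ((s2.mul_left c).tsum_le_tsum (fun n => ?_) s1)
          (by positivity)
        by_cases hz : g (Real.exp (-(n / m))) = 0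
        · simp [hz]
        · have := mul_le_mul_of_nonneg_left (hc n (hgs _ hz).2) (hw0 (n / m))
          linarith
  rw [Metric.tendsto_nhds]
  intro ε hε
  obtain ⟨δ, hδ, hδψ⟩ := Metric.continuousAt_iff.1 hψc (ε / 2) (by positivity)
  have hδψ' : ∀ t : ℝ, |t - 1| < δ → ψ 1 - ε / 2 ≤ ψ t ∧ ψ t ≤ ψ 1 + ε / 2 := by
    intro t ht
    have := hδψ (x := t) (by rwa [Real.dist_eq])
    rw [Real.dist_eq, abs_lt] at this
    constructor <;> linarith [this.1, this.2]
  set d := min (δ / 2) (1 / 2) with hd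
  have hd0 : 0 < d := by positivity
  have hdδ : d < δ := lt_of_le_of_lt (min_le_left _ _) (by linarith)
  have hd1 : d ≤ 1 / 2 := min_le_right _ _
  -- On a window to the right of 1 one has `n ≥ m`, so `h m n ≤ h m m` and the weighted mean bounds
  -- `h m m` from below.
  obtain ⟨u, v, u', v', hu, hv, hv', hA, -, huv⟩ := hb 1 (1 + d) zero_le_one (by linarith)
    (ψ 1 - ε / 2) (ψ 1 + ε / 2) (fun t ht => hδψ' t (by
      rw [abs_lt]; constructor <;> linarith [ht.1, ht.2]))
  -- The window to the left of 1 gives the upper bound in the same way.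
  obtain ⟨w, x, w', x', hw, hx, hx', -, hB, hwx⟩ := hb (1 - d) 1 (by linarith) (by linarith)
    (ψ 1 - ε / 2) (ψ 1 + ε / 2) (fun t ht => hδψ' t (by
      rw [abs_lt]; constructor <;> linarith [ht.1, ht.2]))
  have r1 : ∀ᶠ m in atTop, ψ 1 - ε < u m / v m := by
    refine (hu.div hv hv'.ne').eventually_const_lt ?_
    rw [lt_div_iff₀ hv']; nlinarith
  have r2 : ∀ᶠ m in atTop, w m / x m < ψ 1 + ε := by
    refine (hw.div hx hx'.ne').eventually_lt_const ?_
    rw [div_lt_iff₀ hx']; nlinarith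
  filter_upwards [r1, r2, hv.eventually_const_lt hv', hx.eventually_const_lt hx',
    eventually_gt_atTop 0] with m hm1 hm2 hm3 hm4 hm
  have hm' : (0 : ℝ) < m := by exact_mod_cast hm
  have k1 := (huv m hm).1 (h m m) fun n hn => hanti m (by
    rw [le_div_iff₀ hm', one_mul] at hn; exact_mod_cast hn)
  have k2 := (hwx m hm).2 (h m m) fun n hn => hanti m (by
    rw [div_le_iff₀ hm', one_mul] at hn; exact_mod_cast hn)
  rw [lt_div_iff₀ hm3] at hm1
  rw [div_lt_iff₀ hm4] at hm2
  have k3 : ψ 1 - ε < h m m := lt_of_mul_lt_mul_right (hm1.trans_le k1) hm3.le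
  have k4 : h m m < ψ 1 + ε := lt_of_mul_lt_mul_right (k2.trans_lt hm2) hm4.le
  rw [Real.dist_eq, abs_lt]
  constructor <;> linarith

/-! ### The Mittag-Leffler function and its Laplace transform -/

/-- The Mittag-Leffler function. -/
noncomputable def mittagLeffler (a x : ℝ) : ℝ := ∑' p : ℕ, x ^ p / Real.Gamma (p * a + 1)

/-- Restrict the Gamma integral to `t > T`, where `t ^ x ≥ T ^ x`. Since `T` is free, this shows
that `Γ(p a + 1)` outgrows every geometric sequence in `p`. -/
theorem rpow_mul_exp_neg_le_Gamma {x T : ℝ} (hx : 0 ≤ x) (hT : 0 < T) :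
    T ^ x * Real.exp (-T) ≤ Real.Gamma (x + 1) := by
  rw [Real.Gamma_eq_integral (by linarith), ← integral_exp_neg_Ioi, ← integral_const_mul]
  have hi := Real.GammaIntegral_convergent (s := x + 1) (by linarith)
  have hsub : Set.Ioi T ⊆ Set.Ioi 0 := Set.Ioi_subset_Ioi hT.le
  refine (setIntegral_mono_on (g := fun t => Real.exp (-t) * t ^ (x + 1 - 1))
    ((integrableOn_exp_neg_Ioi T).const_mul _) (hi.mono_set hsub) measurableSet_Ioi
    fun t ht => ?_).trans (setIntegral_mono_set hi ?_ hsub.eventuallyLE)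
  · rw [mul_comm]
    refine mul_le_mul_of_nonneg_left ?_ (Real.exp_pos _).le
    rw [add_sub_cancel_right]
    exact Real.rpow_le_rpow hT.le (le_of_lt ht) hx
  · filter_upwards [ae_restrict_mem measurableSet_Ioi] with t ht
    have ht : 0 < t := ht
    positivity

/-- A geometric bound of the terms of the Mittag-Leffler series. -/
theorem norm_mittagLeffler_term_le {a : ℝ} (ha : 0 < a) {R x : ℝ} (hR : 0 < R) (hx : |x| ≤ R)
    (p : ℕ) : ‖x ^ p / Real.Gamma (p * a + 1)‖ ≤ Real.exp ((2 * R) ^ (1 / a)) * (1 / 2) ^ p := by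
  -- Chosen so that `T ^ (p a) = (2 R) ^ p`, which beats `|x| ^ p` by the factor `2 ^ p`.
  set T := (2 * R) ^ (1 / a) with hT
  have hT0 : 0 < T := by positivity
  have hp : (0 : ℝ) ≤ p * a := by positivity
  have h1 := rpow_mul_exp_neg_le_Gamma hp hT0
  have h2 : T ^ ((p : ℝ) * a) = (2 * R) ^ p := by
    rw [hT, ← Real.rpow_mul (by positivity), ← Real.rpow_natCast]
    congr 1; field_simp
  rw [h2] at h1
  have hG : 0 < Real.Gamma (p * a + 1) := Real.Gamma_pos_of_pos (by linarith)
  rw [norm_div, norm_pow, Real.norm_eq_abs, Real.norm_of_nonneg hG.le, div_le_iff₀ hG]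
  have h3 : |x| ^ p ≤ R ^ p := pow_le_pow_left₀ (abs_nonneg _) hx p
  have h4 : R ^ p = Real.exp T * (1 / 2) ^ p * ((2 * R) ^ p * Real.exp (-T)) := by
    rw [Real.exp_neg, mul_pow, one_div, inv_pow]; field_simp
  rw [h4] at h3
  exact h3.trans (mul_le_mul_of_nonneg_left h1 (by positivity))

theorem summable_mittagLeffler {a : ℝ} (ha : 0 < a) (x : ℝ) :
    Summable fun p : ℕ => x ^ p / Real.Gamma (p * a + 1) :=
  Summable.of_norm_bounded ((summable_geometric_of_lt_one (by norm_num) (by norm_num)).mul_left _)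
    (norm_mittagLeffler_term_le ha (R := |x| + 1) (by positivity) (by linarith))

theorem continuous_mittagLeffler {a : ℝ} (ha : 0 < a) : Continuous (mittagLeffler a) := by
  rw [continuous_iff_continuousAt]
  intro x
  have : ContinuousOn (mittagLeffler a) (Metric.closedBall 0 (|x| + 1)) := by
    refine continuousOn_tsum (u := fun p => Real.exp ((2 * (|x| + 1)) ^ (1 / a)) * (1 / 2) ^ p)
      (fun p => by fun_prop)
      ((summable_geometric_of_lt_one (by norm_num) (by norm_num)).mul_left _) fun p y hy => ?_
    exact norm_mittagLeffler_term_le ha (by positivity) (by simpa using hy) p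
  refine this.continuousAt (Metric.closedBall_mem_nhds_of_mem ?_)
  simp

theorem mittagLeffler_zero (a : ℝ) : mittagLeffler a 0 = 1 := by
  unfold mittagLeffler
  rw [tsum_eq_single 0]
  · simp
  · intro p hp; simp [hp]

theorem integral_exp_mul_rpow {b l : ℝ} (hb : 0 ≤ b) (hl : 0 < l) :
    ∫ t in Set.Ioi (0 : ℝ), Real.exp (-(l * t)) * t ^ b = l⁻¹ * (l⁻¹) ^ b * Real.Gamma (b + 1) := by
  have := Real.integral_rpow_mul_exp_neg_mul_Ioi (a := b + 1) (by linarith) hl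
  simp only [add_sub_cancel_right, one_div] at this
  simp_rw [mul_comm (Real.exp _)]
  rw [this, Real.rpow_add (by positivity), Real.rpow_one]; ring

/-- The integral of a non-integrable function is 0 by default, whereas the value computed above is
positive. -/
theorem integrableOn_exp_mul_rpow {b l : ℝ} (hb : 0 ≤ b) (hl : 0 < l) :
    IntegrableOn (fun t : ℝ => Real.exp (-(l * t)) * t ^ b) (Set.Ioi 0) := by
  by_contra h
  have h1 := integral_undef h
  rw [integral_exp_mul_rpow hb hl] at h1
  have : 0 < l⁻¹ * (l⁻¹) ^ b * Real.Gamma (b + 1) :=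
    mul_pos (by positivity) (Real.Gamma_pos_of_pos (by linarith))
  linarith

/-- The Laplace transform of `t ↦ E_a(-κ tᵃ)`. -/
theorem laplace_mittagLeffler {a κ l : ℝ} (ha : 0 < a) (hκ : 0 ≤ κ) (hl : 0 < l)
    (hlκ : κ * (l⁻¹) ^ a < 1) :
    IntegrableOn (fun t => Real.exp (-(l * t)) * mittagLeffler a (-(κ * t ^ a))) (Set.Ioi 0) ∧
    ∫ t in Set.Ioi (0 : ℝ), Real.exp (-(l * t)) * mittagLeffler a (-(κ * t ^ a))
      = l⁻¹ * (1 + κ * (l⁻¹) ^ a)⁻¹ := by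
  have hq0 : 0 ≤ κ * (l⁻¹) ^ a := by positivity
  set F : ℕ → ℝ → ℝ := fun p t =>
    (-κ) ^ p / Real.Gamma (p * a + 1) * (Real.exp (-(l * t)) * t ^ ((p : ℝ) * a)) with hF
  have hG : ∀ p : ℕ, 0 < Real.Gamma (p * a + 1) := fun p => Real.Gamma_pos_of_pos (by positivity)
  have hpa : ∀ p : ℕ, (0 : ℝ) ≤ p * a := fun p => by positivity
  have hFint : ∀ p, IntegrableOn (F p) (Set.Ioi 0) := fun p =>
    (integrableOn_exp_mul_rpow (hpa p) hl).const_mul _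
  have hpow : ∀ p : ℕ, (l⁻¹) ^ ((p : ℝ) * a) = ((l⁻¹) ^ a) ^ p := fun p => by
    rw [mul_comm, Real.rpow_mul (by positivity), Real.rpow_natCast]
  have hFval : ∀ p, ∫ t in Set.Ioi 0, F p t = l⁻¹ * (-(κ * (l⁻¹) ^ a)) ^ p := fun p => by
    rw [hF, integral_const_mul, integral_exp_mul_rpow (hpa p) hl, hpow]
    have := (hG p).ne'
    rw [← neg_mul, mul_pow]
    field_simp
  have hFnorm : ∀ p, ∫ t in Set.Ioi 0, ‖F p t‖ = l⁻¹ * (κ * (l⁻¹) ^ a) ^ p := fun p => by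
    have e : ∫ t in Set.Ioi 0, ‖F p t‖ = ∫ t in Set.Ioi 0,
        κ ^ p / Real.Gamma (p * a + 1) * (Real.exp (-(l * t)) * t ^ ((p : ℝ) * a)) := by
      refine setIntegral_congr_fun measurableSet_Ioi fun t ht => ?_
      have ht : 0 < t := ht
      simp only [hF]
      rw [norm_mul, norm_div, norm_pow, norm_neg, Real.norm_of_nonneg hκ,
        Real.norm_of_nonneg (hG p).le, Real.norm_of_nonneg (by positivity)]
    rw [e, integral_const_mul, integral_exp_mul_rpow (hpa p) hl, hpow]
    have := (hG p).ne'
    rw [mul_pow]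
    field_simp
  have hs : Summable fun p => ∫ t in Set.Ioi 0, ‖F p t‖ := by
    simp_rw [hFnorm]
    exact (summable_geometric_of_lt_one hq0 hlκ).mul_left _
  have hsum : ∀ t ∈ Set.Ioi (0 : ℝ), HasSum (fun p => F p t)
      (Real.exp (-(l * t)) * mittagLeffler a (-(κ * t ^ a))) := by
    intro t ht
    have ht : 0 < t := ht
    have := (summable_mittagLeffler ha (-(κ * t ^ a))).hasSum.mul_left (Real.exp (-(l * t)))
    refine this.congr_fun fun p => ?_
    simp only [hF]
    rw [← neg_mul κ, mul_pow, mul_comm (p : ℝ) a, Real.rpow_mul ht.le, Real.rpow_natCast]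
    ring
  have hmain := hasSum_integral_of_summable_integral_norm hFint hs
  have hval : ∫ t in Set.Ioi (0 : ℝ), Real.exp (-(l * t)) * mittagLeffler a (-(κ * t ^ a))
      = l⁻¹ * (1 + κ * (l⁻¹) ^ a)⁻¹ := by
    have e : ∫ t in Set.Ioi (0 : ℝ), Real.exp (-(l * t)) * mittagLeffler a (-(κ * t ^ a)) =
        ∫ t in Set.Ioi 0, ∑' p, F p t :=
      setIntegral_congr_fun measurableSet_Ioi fun t ht => (hsum t ht).tsum_eq.symm
    rw [e]
    -- Termwise integration turns the series into a geometric one of ratio `-κ l⁻ᵃ`; hence the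
    -- restriction to large `l`, which the Tauberian theorem tolerates.
    refine hmain.unique ?_
    simp_rw [hFval]
    have hq : |-(κ * (l⁻¹) ^ a)| < 1 := by rw [abs_neg, abs_of_nonneg hq0]; exact hlκ
    have := (hasSum_geometric_of_abs_lt_one hq).mul_left l⁻¹
    rwa [sub_neg_eq_add] at this
  refine ⟨?_, hval⟩
  by_contra h
  have h1 := integral_undef h
  rw [hval] at h1
  have : 0 < l⁻¹ * (1 + κ * (l⁻¹) ^ a)⁻¹ := by positivity
  linarith

/-! ### The birth and death chain: transition probabilities and reversibility -/

/-- Probability of a step up. -/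
noncomputable def gegenbauerUp (α : ℝ) (x : ℕ) : ℝ :=
  if x = 0 then 1 else (x + 2 * α + 1) / (2 * x + 2 * α + 1)

/-- Probability of a step down. -/
noncomputable def gegenbauerDown (α : ℝ) (x : ℕ) : ℝ := x / (2 * x + 2 * α + 1)

@[simp] theorem gegenbauerUp_zero (α : ℝ) : gegenbauerUp α 0 = 1 := by simp [gegenbauerUp]

@[simp] theorem gegenbauerDown_zero (α : ℝ) : gegenbauerDown α 0 = 0 := by simp [gegenbauerDown]

theorem gegenbauerUp_succ (α : ℝ) (x : ℕ) :
    gegenbauerUp α (x + 1) = (x + 2 * α + 2) / (2 * x + 2 * α + 3) := by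
  simp only [gegenbauerUp, Nat.add_eq_zero_iff, one_ne_zero, and_false, if_false]
  push_cast; congr 1 <;> ring

theorem gegenbauerDown_succ (α : ℝ) (x : ℕ) :
    gegenbauerDown α (x + 1) = (x + 1) / (2 * x + 2 * α + 3) := by
  simp only [gegenbauerDown]
  push_cast; congr 1; ring

theorem gegenbauer_den_pos {α : ℝ} (hα : -1 / 2 ≤ α) (x : ℕ) : 0 < 2 * (x : ℝ) + 2 * α + 3 := by
  have : (0 : ℝ) ≤ x := x.cast_nonneg
  linarith

theorem gegenbauerUp_pos {α : ℝ} (hα : -1 / 2 ≤ α) (x : ℕ) : 0 < gegenbauerUp α x := by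
  rcases x with _ | x
  · simp
  · rw [gegenbauerUp_succ]
    have := gegenbauer_den_pos hα x
    have : (0 : ℝ) ≤ x := x.cast_nonneg
    exact div_pos (by linarith) (by linarith)

theorem gegenbauerDown_nonneg {α : ℝ} (hα : -1 / 2 ≤ α) (x : ℕ) : 0 ≤ gegenbauerDown α x := by
  rcases x with _ | x
  · simp
  · rw [gegenbauerDown_succ]
    have := gegenbauer_den_pos hα x
    positivity

theorem gegenbauerUp_add_down {α : ℝ} (hα : -1 / 2 ≤ α) (x : ℕ) :
    gegenbauerUp α x + gegenbauerDown α x = 1 := by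
  rcases x with _ | x
  · simp
  · rw [gegenbauerUp_succ, gegenbauerDown_succ, ← add_div, div_eq_one_iff_eq
      (gegenbauer_den_pos hα x).ne']
    ring

/-- The `n`-step transition probabilities. -/
noncomputable def nStep (α : ℝ) : ℕ → ℕ → ℕ → ℝ
  | 0, x, y => if x = y then 1 else 0
  -- At `x = 0` the truncated `x - 1` is harmless, as the step down has weight 0 there.
  | n + 1, x, y => gegenbauerUp α x * nStep α n (x + 1) y + gegenbauerDown α x * nStep α n (x - 1) y

theorem nStep_nonneg {α : ℝ} (hα : -1 / 2 ≤ α) (n x y : ℕ) : 0 ≤ nStep α n x y := by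
  induction n generalizing x with
  | zero => simp only [nStep]; split_ifs <;> norm_num
  | succ n ih =>
    exact add_nonneg (mul_nonneg (gegenbauerUp_pos hα x).le (ih _))
      (mul_nonneg (gegenbauerDown_nonneg hα x) (ih _))

theorem nStep_le_one {α : ℝ} (hα : -1 / 2 ≤ α) (n x y : ℕ) : nStep α n x y ≤ 1 := by
  induction n generalizing x with
  | zero => simp only [nStep]; split_ifs <;> norm_num
  | succ n ih =>
    have h1 := mul_le_mul_of_nonneg_left (ih (x + 1)) (gegenbauerUp_pos hα x).le
    have h2 := mul_le_mul_of_nonneg_left (ih (x - 1)) (gegenbauerDown_nonneg hα x)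
    have h3 := gegenbauerUp_add_down hα x
    simp only [nStep]; linarith

/-- `nStep` is defined by its first step; this lemma and the next decompose along the last step
instead, which is what reversibility has to be compared with. -/
theorem nStep_succ_zero_right (α : ℝ) (n x : ℕ) :
    nStep α (n + 1) x 0 = nStep α n x 1 * gegenbauerDown α 1 := by
  induction n generalizing x with
  | zero =>
    rcases x with _ | _ | x <;> simp [nStep]
  | succ n ih =>
    rw [nStep, ih, ih, nStep]; ring

theorem nStep_succ_succ_right (α : ℝ) (n x y : ℕ) :
    nStep α (n + 1) x (y + 1) =
      nStep α n x (y + 2) * gegenbauerDown α (y + 2) + nStep α n x y * gegenbauerUp α y := by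
  induction n generalizing x with
  | zero =>
    rcases x with _ | x
    · simp only [nStep, gegenbauerDown_zero]
      by_cases h : y = 0
      · subst h; simp
      · have h1 : ¬ (0 = y) := fun h' => h h'.symm
        simp [h, h1]
    · simp only [nStep, Nat.add_sub_cancel]
      by_cases h1 : x + 1 = y
      · subst h1; simp; omega
      · by_cases h2 : x = y + 1
        · subst h2
          have h3 : ¬ (y + 1 + 1 = y) := by omega
          simp [h3]
        · simp [h1, h2]
  | succ n ih =>
    rw [nStep, ih, ih, nStep, nStep]; ring

/-- A reversible measure of the chain. -/
noncomputable def gegenbauerInvariant (α : ℝ) (y : ℕ) : ℝ :=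
  gegenbauerWeight α y / (Real.Gamma (y + 1) * Real.Gamma (2 * α + 2))

/-- The convention `0 × Γ(0) = 1` is what keeps this true at `α = -1/2`; elsewhere it is the
functional equation of `Γ`. -/
theorem gegenbauerWeight_zero (α : ℝ) :
    gegenbauerWeight α 0 = Real.Gamma (2 * α + 2) := by
  unfold gegenbauerWeight
  split_ifs with h
  · have : 2 * α + 2 = 1 := by push_cast at h; linarith
    rw [this, Real.Gamma_one]
  · have h' : 2 * α + 1 ≠ 0 := by push_cast at h; intro h2; apply h; linarith
    rw [show 2 * α + 2 = (2 * α + 1) + 1 by ring, Real.Gamma_add_one h']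
    push_cast; ring_nf

theorem gegenbauerWeight_succ {α : ℝ} (hα : -1 / 2 ≤ α) (y : ℕ) :
    gegenbauerWeight α (y + 1) = (2 * y + 2 * α + 3) * Real.Gamma (y + 2 * α + 2) := by
  have := gegenbauer_den_pos hα y
  unfold gegenbauerWeight
  rw [if_neg (by push_cast; linarith)]
  push_cast; ring_nf

theorem gegenbauerInvariant_zero {α : ℝ} (hα : -1 / 2 ≤ α) : gegenbauerInvariant α 0 = 1 := by
  have : 0 < Real.Gamma (2 * α + 2) := Real.Gamma_pos_of_pos (by linarith)
  rw [gegenbauerInvariant, gegenbauerWeight_zero]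
  simp [this.ne']

/-- Detailed balance: both sides reduce through `Γ(s + 1) = s Γ(s)`. The origin is separate because
its step up does not follow the general formula. -/
theorem gegenbauerInvariant_balance {α : ℝ} (hα : -1 / 2 ≤ α) (y : ℕ) :
    gegenbauerInvariant α y * gegenbauerUp α y =
      gegenbauerInvariant α (y + 1) * gegenbauerDown α (y + 1) := by
  have hG : 0 < Real.Gamma (2 * α + 2) := Real.Gamma_pos_of_pos (by linarith)
  have hden := gegenbauer_den_pos hα y
  unfold gegenbauerInvariant
  rw [gegenbauerWeight_succ hα, gegenbauerDown_succ]
  have hy : Real.Gamma ((y + 1 : ℕ) + 1) = (y + 1) * Real.Gamma (y + 1) := by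
    push_cast; rw [Real.Gamma_add_one (by positivity)]
  rw [hy]
  have hyG : 0 < Real.Gamma ((y : ℝ) + 1) := Real.Gamma_pos_of_pos (by positivity)
  rcases y with _ | y
  · rw [gegenbauerWeight_zero, gegenbauerUp_zero]
    simp only [Nat.cast_zero, mul_zero, zero_add, mul_one, one_mul, Real.Gamma_one] at *
    generalize Real.Gamma (2 * α + 2) = G at *
    generalize 2 * α + 3 = D at *
    field_simp
  · rw [gegenbauerWeight_succ hα, gegenbauerUp_succ]
    have hden' := gegenbauer_den_pos hα y
    have h0 : 0 < (y : ℝ) + 2 * α + 2 := by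
      have : (0 : ℝ) ≤ y := y.cast_nonneg
      linarith
    have : Real.Gamma ((y + 1 : ℕ) + 2 * α + 2) = (y + 2 * α + 2) * Real.Gamma (y + 2 * α + 2) := by
      push_cast
      rw [← Real.Gamma_add_one h0.ne']; ring_nf
    rw [this]
    push_cast at *
    generalize Real.Gamma (2 * α + 2) = G at *
    generalize Real.Gamma ((y : ℝ) + 1 + 1) = G' at *
    generalize Real.Gamma (y + 2 * α + 2) = G'' at *
    generalize 2 * ((y : ℝ) + 1) + 2 * α + 3 = D at *
    generalize 2 * (y : ℝ) + 2 * α + 3 = D' at *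
    field_simp

/-- Detailed balance exchanges the first-step decomposition from `x` with the last-step
decomposition into `x`. -/
theorem nStep_reversible {α : ℝ} (hα : -1 / 2 ≤ α) (n x y : ℕ) :
    gegenbauerInvariant α x * nStep α n x y = gegenbauerInvariant α y * nStep α n y x := by
  induction n generalizing x with
  | zero =>
    by_cases h : x = y
    · subst h; rfl
    · simp [nStep, h, Ne.symm h]
  | succ n ih =>
    rcases x with _ | x
    · rw [nStep_succ_zero_right, nStep, gegenbauerDown_zero, zero_mul, add_zero, ← mul_assoc,
        gegenbauerInvariant_balance hα, ← mul_assoc, ← ih]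
      ring
    · rw [nStep_succ_succ_right, nStep, mul_add, ← mul_assoc, ← mul_assoc,
        gegenbauerInvariant_balance hα, ← gegenbauerInvariant_balance hα x, mul_add, ← mul_assoc,
        ← mul_assoc, ← ih, ← ih, Nat.add_sub_cancel]
      ring

/-! ### Closed form of the probabilities of reaching the origin -/

open Nat in
/-- Closed form of the probability of being at `0` after `x + 2k` steps from `x`. -/
noncomputable def returnProb (α : ℝ) (k x : ℕ) : ℝ :=
  (1 / 2) ^ x * ((x + 2 * k)! / (2 * k)! : ℝ) * (∏ j ∈ Finset.range k, (1 / 2 + (j : ℝ))) /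
    ∏ j ∈ Finset.range (k + x), (α + 3 / 2 + (j : ℝ))

theorem pochhammer_pos {s : ℝ} (hs : 0 < s) (k : ℕ) : 0 < ∏ j ∈ Finset.range k, (s + (j : ℝ)) :=
  Finset.prod_pos fun j _ => by positivity

/-- This and the next two lemmas are the first-step equations satisfied by the closed form: at the
origin, along the shortest path, and everywhere else. Together they determine it by induction on the
number of steps. -/
theorem returnProb_succ_zero {α : ℝ} (hα : -1 / 2 ≤ α) (k : ℕ) :
    returnProb α (k + 1) 0 = returnProb α k 1 := by
  unfold returnProb
  have h1 : (((2 * (k + 1)).factorial : ℕ) : ℝ) ≠ 0 := by exact_mod_cast Nat.factorial_ne_zero _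
  have h2 : (((2 * k).factorial : ℕ) : ℝ) ≠ 0 := by exact_mod_cast Nat.factorial_ne_zero _
  have h3 := (pochhammer_pos (s := α + 3 / 2) (by linarith) (k + 1)).ne'
  rw [Finset.prod_range_succ _ k, show 1 + 2 * k = 2 * k + 1 by ring, Nat.factorial_succ (2 * k)]
  simp only [zero_add, add_zero, pow_zero, pow_one]
  push_cast
  field_simp
  ring

theorem returnProb_zero_succ {α : ℝ} (hα : -1 / 2 ≤ α) (x : ℕ) :
    returnProb α 0 (x + 1) = gegenbauerDown α (x + 1) * returnProb α 0 x := by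
  unfold returnProb
  have h3 := (pochhammer_pos (s := α + 3 / 2) (by linarith) x).ne'
  have hden := (gegenbauer_den_pos hα x).ne'
  have hx : α + 3 / 2 + (x : ℝ) = (2 * x + 2 * α + 3) / 2 := by ring
  rw [gegenbauerDown_succ]
  simp only [mul_zero, add_zero, zero_add, Finset.prod_range_zero, Nat.factorial_zero,
    Nat.factorial_succ, Finset.prod_range_succ, hx, pow_succ]
  push_cast
  field_simp

theorem returnProb_succ_succ {α : ℝ} (hα : -1 / 2 ≤ α) (k x : ℕ) :
    returnProb α (k + 1) (x + 1) = gegenbauerUp α (x + 1) * returnProb α k (x + 2) +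
      gegenbauerDown α (x + 1) * returnProb α (k + 1) x := by
  unfold returnProb
  have h2 : (((2 * k).factorial : ℕ) : ℝ) ≠ 0 := by exact_mod_cast Nat.factorial_ne_zero _
  have h4 : (((x + 2 * k).factorial : ℕ) : ℝ) ≠ 0 := by exact_mod_cast Nat.factorial_ne_zero _
  have h3 := (pochhammer_pos (s := α + 3 / 2) (by linarith) (k + x + 1)).ne'
  have hden := (gegenbauer_den_pos hα x).ne'
  have hk : α + 3 / 2 + ((k + x + 1 : ℕ) : ℝ) ≠ 0 := by
    have : 0 < α + 3 / 2 := by linarith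
    positivity
  rw [gegenbauerDown_succ, gegenbauerUp_succ,
    show k + 1 + (x + 1) = k + x + 1 + 1 by ring, show k + (x + 2) = k + x + 1 + 1 by ring,
    show k + 1 + x = k + x + 1 by ring,
    show x + 1 + 2 * (k + 1) = x + 2 * k + 1 + 1 + 1 by ring,
    show x + 2 + 2 * k = x + 2 * k + 1 + 1 by ring,
    show x + 2 * (k + 1) = x + 2 * k + 1 + 1 by ring,
    show 2 * (k + 1) = 2 * k + 1 + 1 by ring]
  simp only [Nat.factorial_succ]
  rw [Finset.prod_range_succ _ (k + x + 1), Finset.prod_range_succ _ k, pow_succ, pow_succ _ (x + 1),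
    pow_succ]
  push_cast at *
  generalize ∏ j ∈ Finset.range (k + x + 1), (α + 3 / 2 + (j : ℝ)) = Q at *
  generalize ∏ j ∈ Finset.range k, (1 / 2 + (j : ℝ)) = R at *
  generalize hD : 2 * (x : ℝ) + 2 * α + 3 = D at *
  generalize hE : α + 3 / 2 + ((k : ℝ) + x + 1) = E at *
  field_simp
  rw [← hE, ← hD]
  ring

theorem nStep_zero_right {α : ℝ} (hα : -1 / 2 ≤ α) (n x : ℕ) :
    (∀ k, n = x + 2 * k → nStep α n x 0 = returnProb α k x) ∧
      ((∀ k, n ≠ x + 2 * k) → nStep α n x 0 = 0) := by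
  induction n generalizing x with
  | zero =>
    constructor
    · intro k hk
      obtain ⟨rfl, rfl⟩ : x = 0 ∧ k = 0 := by omega
      simp [nStep, returnProb]
    · intro h
      have : x ≠ 0 := fun hx => h 0 (by omega)
      simp [nStep, this]
  | succ n ih =>
    rcases x with _ | x
    · simp only [nStep, gegenbauerUp_zero, gegenbauerDown_zero, one_mul, zero_mul, add_zero]
      constructor
      · intro k hk
        obtain ⟨k, rfl⟩ : ∃ j, k = j + 1 := ⟨k - 1, by omega⟩
        rw [returnProb_succ_zero hα]
        exact (ih 1).1 k (by omega)
      · intro h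
        exact (ih 1).2 fun k hk => h (k + 1) (by omega)
    · simp only [nStep, Nat.add_sub_cancel]
      constructor
      · intro k hk
        rw [(ih x).1 k (by omega)]
        rcases k with _ | k
        -- With `k = 0` there is no time to step up: from `x + 2` the origin is out of reach in `x`
        -- steps.
        · rw [(ih (x + 1 + 1)).2 (fun k hk => by omega), returnProb_zero_succ hα]; ring
        · rw [(ih (x + 1 + 1)).1 k (by omega), returnProb_succ_succ hα]
      · intro h
        rw [(ih (x + 1 + 1)).2 (fun k hk => h (k + 1) (by omega)),
          (ih x).2 (fun k hk => h k (by omega))]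
        ring

/-! ### The Green function and its dependence on the two points -/

/-- The Green function `G_z(x, y) = ∑ₙ zⁿ pⁿ(x, y)`. -/
noncomputable def green (α z : ℝ) (x y : ℕ) : ℝ := ∑' n : ℕ, z ^ n * nStep α n x y

theorem summable_green {α z : ℝ} (hα : -1 / 2 ≤ α) (hz0 : 0 ≤ z) (hz1 : z < 1) (x y : ℕ) :
    Summable fun n : ℕ => z ^ n * nStep α n x y :=
  Summable.of_nonneg_of_le (fun n => mul_nonneg (pow_nonneg hz0 n) (nStep_nonneg hα n x y))
    (fun n => mul_le_of_le_one_right (pow_nonneg hz0 n) (nStep_le_one hα n x y))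
    (summable_geometric_of_lt_one hz0 hz1)

theorem green_nonneg {α z : ℝ} (hα : -1 / 2 ≤ α) (hz0 : 0 ≤ z) (x y : ℕ) :
    0 ≤ green α z x y :=
  tsum_nonneg fun n => mul_nonneg (pow_nonneg hz0 n) (nStep_nonneg hα n x y)

theorem green_le {α z : ℝ} (hα : -1 / 2 ≤ α) (hz0 : 0 ≤ z) (hz1 : z < 1) (x y : ℕ) :
    green α z x y ≤ (1 - z)⁻¹ := by
  rw [← tsum_geometric_of_lt_one hz0 hz1]
  exact (summable_green hα hz0 hz1 x y).tsum_le_tsum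
    (fun n => mul_le_of_le_one_right (pow_nonneg hz0 n) (nStep_le_one hα n x y))
    (summable_geometric_of_lt_one hz0 hz1)

theorem green_eq {α z : ℝ} (hα : -1 / 2 ≤ α) (hz0 : 0 ≤ z) (hz1 : z < 1) (x y : ℕ) :
    green α z x y = (if x = y then 1 else 0) + z * (gegenbauerUp α x * green α z (x + 1) y +
      gegenbauerDown α x * green α z (x - 1) y) := by
  have s1 := summable_green hα hz0 hz1 (x + 1) y
  have s2 := summable_green hα hz0 hz1 (x - 1) y
  rw [green, (summable_green hα hz0 hz1 x y).tsum_eq_zero_add]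
  congr 1
  · simp [nStep]
  · rw [green, green, ← tsum_mul_left, ← tsum_mul_left,
      ← (s1.mul_left _).tsum_add (s2.mul_left _), ← tsum_mul_left]
    refine tsum_congr fun n => ?_
    rw [nStep]; ring

theorem green_reversible {α : ℝ} (hα : -1 / 2 ≤ α) (z : ℝ) (x y : ℕ) :
    gegenbauerInvariant α x * green α z x y = gegenbauerInvariant α y * green α z y x := by
  rw [green, green, ← tsum_mul_left, ← tsum_mul_left]
  refine tsum_congr fun n => ?_
  rw [mul_left_comm, nStep_reversible hα, mul_left_comm]

theorem green_zero_zero {α : ℝ} (hα : -1 / 2 ≤ α) (z : ℝ) :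
    green α z 0 0 = ∑' k : ℕ, (∏ j ∈ Finset.range k, (1 / 2 + (j : ℝ))) /
      (∏ j ∈ Finset.range k, (α + 3 / 2 + (j : ℝ))) * (z ^ 2) ^ k := by
  have hinj : Function.Injective fun k : ℕ => 2 * k := fun a b h => by simpa using h
  rw [green, ← hinj.tsum_eq]
  · refine tsum_congr fun k => ?_
    have h1 : (((2 * k).factorial : ℕ) : ℝ) ≠ 0 := by exact_mod_cast Nat.factorial_ne_zero _
    rw [(nStep_zero_right hα (2 * k) 0).1 k (by ring), returnProb, ← pow_mul, mul_comm]
    simp [h1]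
  · intro n hn
    by_contra hc
    apply hn
    change z ^ n * nStep α n 0 0 = 0
    rw [(nStep_zero_right hα n 0).2 (fun k hk => hc ⟨k, by change 2 * k = n; omega⟩), mul_zero]

open Topology in
/-- The Green function has the same asymptotics from every starting point. -/
theorem tendsto_green_start {α : ℝ} (hα : -1 / 2 ≤ α) {z L : ℕ → ℝ} {c : ℝ}
    (hz : ∀ᶠ m in atTop, 0 < z m ∧ z m < 1) (hz1 : Tendsto z atTop (𝓝 1))
    (hL : Tendsto L atTop atTop) {y : ℕ}
    (h : Tendsto (fun m => green α (z m) 0 y / L m) atTop (𝓝 c)) (x : ℕ) :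
    Tendsto (fun m => green α (z m) x y / L m) atTop (𝓝 c) := by
  have step : ∀ x, Tendsto (fun m => green α (z m) x y / L m) atTop (𝓝 c) →
      Tendsto (fun m => green α (z m) (x - 1) y / L m) atTop (𝓝 c) →
      Tendsto (fun m => green α (z m) (x + 1) y / L m) atTop (𝓝 c) := by
    intro x h1 h2
    have h3 : Tendsto (fun m => (if x = y then (1 : ℝ) else 0) / L m) atTop (𝓝 0) :=
      tendsto_const_nhds.div_atTop hL
    have hup := gegenbauerUp_pos hα x
    -- The first-step equation is solved for the term at `x + 1`; the indicator disappears after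
    -- division by `L`, and the limit is again `c` because the weights sum to 1.
    have h4 := (((h1.sub h3).div hz1 one_ne_zero).sub (h2.const_mul (gegenbauerDown α x))).div_const
      (gegenbauerUp α x)
    have e : ((c - 0) / 1 - gegenbauerDown α x * c) / gegenbauerUp α x = c := by
      rw [div_eq_iff hup.ne']
      have := gegenbauerUp_add_down hα x
      linear_combination c * (-this)
    rw [e] at h4
    refine h4.congr' ?_
    filter_upwards [hz] with m hm
    have := green_eq hα hm.1.le hm.2 x y
    have hz0 := hm.1.ne'
    simp only [Pi.div_apply]
    rw [this]
    field_simp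
    ring
  have : ∀ x, Tendsto (fun m => green α (z m) x y / L m) atTop (𝓝 c) ∧
      Tendsto (fun m => green α (z m) (x + 1) y / L m) atTop (𝓝 c) := by
    intro x
    induction x with
    | zero => exact ⟨h, step 0 h h⟩
    | succ x ih => exact ⟨ih.2, step (x + 1) ih.2 ih.1⟩
  exact (this x).1

open Topology in
theorem tendsto_green {α : ℝ} (hα : -1 / 2 ≤ α) {z L : ℕ → ℝ} {c : ℝ}
    (hz : ∀ᶠ m in atTop, 0 < z m ∧ z m < 1) (hz1 : Tendsto z atTop (𝓝 1))
    (hL : Tendsto L atTop atTop)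
    (h : Tendsto (fun m => green α (z m) 0 0 / L m) atTop (𝓝 c)) (x y : ℕ) :
    Tendsto (fun m => green α (z m) x y / L m) atTop (𝓝 (gegenbauerInvariant α y * c)) := by
  -- Reversibility turns the target `y` into a starting point: `G(0, y) = π(y) G(y, 0)`, where `π`
  -- is the invariant measure with `π(0) = 1`.
  refine tendsto_green_start hα hz hz1 hL ?_ x
  refine ((tendsto_green_start hα hz hz1 hL h y).const_mul (gegenbauerInvariant α y)).congr
    fun m => ?_
  rw [← mul_div_assoc, ← green_reversible hα, gegenbauerInvariant_zero hα, one_mul]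

/-! ### Asymptotics of the Green function at the origin -/

open Topology in
/-- Abelian comparison of power series with asymptotically proportional coefficients. -/
theorem tendsto_powerSeries_div {a b : ℕ → ℝ} {c d : ℝ} {w L : ℕ → ℝ} (hb : ∀ k, 0 ≤ b k)
    (hbs : ∀ v : ℝ, 0 ≤ v → v < 1 → Summable fun k => b k * v ^ k)
    (hab : ∀ ε > 0, ∀ᶠ k in atTop, |a k - c * b k| ≤ ε * b k)
    (hw : ∀ᶠ m in atTop, 0 ≤ w m ∧ w m < 1) (hL : Tendsto L atTop atTop)
    (h : Tendsto (fun m => (∑' k, b k * w m ^ k) / L m) atTop (𝓝 d)) :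
    Tendsto (fun m => (∑' k, a k * w m ^ k) / L m) atTop (𝓝 (c * d)) := by
  have has : ∀ v : ℝ, 0 ≤ v → v < 1 → Summable fun k => (a k - c * b k) * v ^ k := by
    intro v hv0 hv1
    refine Summable.of_norm_bounded_eventually_nat (hbs v hv0 hv1) ?_
    filter_upwards [hab 1 one_pos] with k hk
    rw [norm_mul, Real.norm_of_nonneg (pow_nonneg hv0 k)]
    exact mul_le_mul_of_nonneg_right (by simpa using hk) (pow_nonneg hv0 k)
  have key : Tendsto (fun m => (∑' k, (a k - c * b k) * w m ^ k) / L m) atTop (𝓝 0) := by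
    rw [Metric.tendsto_nhds]
    intro ε hε
    -- The tail beyond `K` costs at most `η (|d| + 1) = ε / 2`; the first `K` terms are bounded by
    -- `A` and vanish after division by `L`.
    set η := ε / (2 * (|d| + 1)) with hη
    have hη0 : 0 < η := by positivity
    have hηd : η * (|d| + 1) = ε / 2 := by rw [hη]; field_simp
    obtain ⟨K, hK⟩ := eventually_atTop.1 (hab η hη0)
    set A := ∑ k ∈ Finset.range K, |a k - c * b k| with hA
    have hA0 : 0 ≤ A := Finset.sum_nonneg fun k _ => abs_nonneg _
    have e1 : ∀ᶠ m in atTop, (∑' k, b k * w m ^ k) / L m < |d| + 1 :=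
      h.eventually_lt_const (by linarith [le_abs_self d])
    have e2 : ∀ᶠ m in atTop, A / L m < ε / 2 :=
      (tendsto_const_nhds.div_atTop hL).eventually_lt_const (by positivity)
    filter_upwards [hw, e1, e2, hL.eventually_gt_atTop 0] with m hm h1 h2 hLm
    rw [Real.dist_eq, sub_zero, abs_div, abs_of_pos hLm]
    have hbound : |∑' k, (a k - c * b k) * w m ^ k| ≤ A + η * ∑' k, b k * w m ^ k := by
      rw [← (has _ hm.1 hm.2).sum_add_tsum_nat_add K]
      refine (abs_add_le _ _).trans (add_le_add ?_ ?_)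
      · refine (Finset.abs_sum_le_sum_abs _ _).trans (Finset.sum_le_sum fun k _ => ?_)
        rw [abs_mul, abs_of_nonneg (pow_nonneg hm.1 k)]
        exact mul_le_of_le_one_right (abs_nonneg _) (pow_le_one₀ hm.1 hm.2.le)
      · have hs := (hbs _ hm.1 hm.2).mul_left η
        have hs' := (summable_nat_add_iff K).2 hs
        have t1 : |∑' k, (a (k + K) - c * b (k + K)) * w m ^ (k + K)| ≤
            ∑' k, η * (b (k + K) * w m ^ (k + K)) := by
          rw [← Real.norm_eq_abs]
          refine tsum_of_norm_bounded hs'.hasSum fun k => ?_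
          rw [norm_mul, Real.norm_of_nonneg (pow_nonneg hm.1 _), ← mul_assoc]
          exact mul_le_mul_of_nonneg_right (hK _ (by omega)) (pow_nonneg hm.1 _)
        refine t1.trans ?_
        rw [← tsum_mul_left, ← hs.sum_add_tsum_nat_add K]
        have : 0 ≤ ∑ k ∈ Finset.range K, η * (b k * w m ^ k) :=
          Finset.sum_nonneg fun k _ => mul_nonneg hη0.le (mul_nonneg (hb k) (pow_nonneg hm.1 k))
        linarith
    rw [div_lt_iff₀ hLm] at h1 h2 ⊢
    have := mul_lt_mul_of_pos_left h1 hη0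
    nlinarith
  have := key.add (h.const_mul c)
  rw [zero_add] at this
  refine this.congr' ?_
  filter_upwards [hw] with m hm
  rw [← mul_div_assoc, ← add_div, ← tsum_mul_left,
    ← (has _ hm.1 hm.2).tsum_add ((hbs _ hm.1 hm.2).mul_left c)]
  congr 2; ext k; ring

theorem abs_sub_le_of_tendsto_div {a b : ℕ → ℝ} {c : ℝ} (hb : ∀ᶠ k in atTop, 0 < b k)
    (h : Tendsto (fun k => a k / b k) atTop (nhds c)) :
    ∀ ε > 0, ∀ᶠ k in atTop, |a k - c * b k| ≤ ε * b k := by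
  intro ε hε
  filter_upwards [hb, (Metric.tendsto_nhds.1 h) ε hε] with k hk hd
  rw [Real.dist_eq] at hd
  have : a k - c * b k = (a k / b k - c) * b k := by field_simp
  rw [this, abs_mul, abs_of_pos hk]
  exact mul_le_mul_of_nonneg_right hd.le hk.le

theorem exp_neg_div_mem {l : ℝ} (hl : 0 < l) :
    ∀ᶠ m : ℕ in atTop, 0 < Real.exp (-(l / m)) ∧ Real.exp (-(l / m)) < 1 := by
  filter_upwards [eventually_gt_atTop 0] with m hm
  have hm' : (0 : ℝ) < m := by exact_mod_cast hm
  refine ⟨Real.exp_pos _, ?_⟩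
  rw [Real.exp_lt_one_iff]
  have : 0 < l / m := by positivity
  linarith

open Topology in
theorem tendsto_exp_neg_div (l : ℝ) {L : ℕ → ℝ} (hL : Tendsto L atTop atTop) :
    Tendsto (fun m : ℕ => Real.exp (-(l / L m))) atTop (𝓝 1) := by
  have h1 : Tendsto (fun m : ℕ => -(l / L m)) atTop (𝓝 (-0)) :=
    (tendsto_const_nhds.div_atTop hL).neg
  rw [← Real.exp_zero, ← neg_zero]
  exact (Real.continuous_exp.tendsto _).comp h1

theorem exp_neg_div_sq (l : ℝ) (m : ℕ) :
    Real.exp (-(l / m)) ^ 2 = Real.exp (-((2 * l) / m)) := by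
  rw [← Real.exp_nat_mul]; congr 1; push_cast; ring

theorem choose_eq_pochhammer (a : ℝ) (k : ℕ) :
    Ring.choose (a + k - 1) k = (∏ j ∈ Finset.range k, (a + (j : ℝ))) / k.factorial := by
  have h := Ring.descPochhammer_eq_factorial_smul_choose (a + k - 1) k
  have hk : ((k.factorial : ℕ) : ℝ) ≠ 0 := by exact_mod_cast Nat.factorial_ne_zero _
  rw [eq_div_iff hk, mul_comm, ← nsmul_eq_mul, ← h, Polynomial.descPochhammer_smeval_eq_ascPochhammer,
    Polynomial.ascPochhammer_smeval_cast, Polynomial.ascPochhammer_smeval_eq_eval,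
    show a + k - 1 - k + 1 = a by ring]
  clear h
  clear hk
  induction k with
  | zero => simp
  | succ k ih => rw [ascPochhammer_succ_eval, ih, Finset.prod_range_succ]

theorem hasSum_binomial (a : ℝ) {w : ℝ} (hw0 : 0 ≤ w) (hw1 : w < 1) :
    HasSum (fun k : ℕ => (∏ j ∈ Finset.range k, (a + (j : ℝ))) / k.factorial * w ^ k)
      ((1 - w) ^ (-a)) := by
  have h := (Real.one_div_one_sub_rpow_hasFPowerSeriesOnBall_zero a).hasSum (y := w) (by
    rw [← ENNReal.ofReal_one, Metric.eball_ofReal]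
    simpa [abs_of_nonneg hw0] using hw1)
  simp only [FormalMultilinearSeries.ofScalars_apply_eq, zero_add, smul_eq_mul,
    choose_eq_pochhammer] at h
  rwa [Real.rpow_neg (by linarith), ← one_div]

-- Euler's limit formula for `Γ`, applied to the four Pochhammer products (`k!` being that of 1).
-- The powers of `k` cancel since `(-a + 3/2) + a = 1/2 + 1`.
open Topology in
theorem tendsto_pochhammer_ratio {a : ℝ} (ha : 0 < a) (ha1 : a < 1) :
    Tendsto (fun k : ℕ => ((∏ j ∈ Finset.range k, (1 / 2 + (j : ℝ))) /
      ∏ j ∈ Finset.range k, (-a + 3 / 2 + (j : ℝ))) /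
        ((∏ j ∈ Finset.range k, (a + (j : ℝ))) / k.factorial)) atTop
      (𝓝 (Real.Gamma (-a + 3 / 2) * Real.Gamma a / Real.Gamma (1 / 2))) := by
  -- `Real.GammaSeq s k` has `k + 1` factors, hence the shift.
  rw [← tendsto_add_atTop_iff_nat 1]
  have h1 := ((Real.GammaSeq_tendsto_Gamma (-a + 3 / 2)).mul (Real.GammaSeq_tendsto_Gamma a)).div
    ((Real.GammaSeq_tendsto_Gamma (1 / 2)).mul (Real.GammaSeq_tendsto_Gamma 1)) (by
      rw [Real.Gamma_one, mul_one]
      exact (Real.Gamma_pos_of_pos (by norm_num)).ne')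
  rw [Real.Gamma_one, mul_one] at h1
  refine h1.congr' ?_
  filter_upwards [eventually_gt_atTop 0] with k hk
  have hk' : (0 : ℝ) < k := by exact_mod_cast hk
  have p1 := (pochhammer_pos (s := 1 / 2) (by norm_num) (k + 1)).ne'
  have p2 := (pochhammer_pos (s := -a + 3 / 2) (by linarith) (k + 1)).ne'
  have p3 := (pochhammer_pos ha (k + 1)).ne'
  have p4 : ∏ j ∈ Finset.range (k + 1), (1 + (j : ℝ)) = (k + 1).factorial := by
    rw [← Finset.prod_range_add_one_eq_factorial]; push_cast
    exact Finset.prod_congr rfl fun j _ => by ring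
  have hf : (((k + 1).factorial : ℕ) : ℝ) ≠ 0 := by exact_mod_cast Nat.factorial_ne_zero _
  have hf' : ((k.factorial : ℕ) : ℝ) ≠ 0 := by exact_mod_cast Nat.factorial_ne_zero _
  have hp : (k : ℝ) ^ (-a + 3 / 2) * (k : ℝ) ^ a = (k : ℝ) ^ (1 / 2 : ℝ) * (k : ℝ) ^ (1 : ℝ) := by
    rw [← Real.rpow_add hk', ← Real.rpow_add hk']; congr 1; ring
  have q1 : (k : ℝ) ^ (1 / 2 : ℝ) ≠ 0 := by positivity
  have q2 : (k : ℝ) ^ (1 : ℝ) ≠ 0 := by positivity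
  simp only [Pi.div_apply, Real.GammaSeq]
  rw [p4]
  generalize ∏ j ∈ Finset.range (k + 1), (1 / 2 + (j : ℝ)) = P1 at *
  generalize ∏ j ∈ Finset.range (k + 1), (-a + 3 / 2 + (j : ℝ)) = P2 at *
  generalize ∏ j ∈ Finset.range (k + 1), (a + (j : ℝ)) = P3 at *
  generalize (k : ℝ) ^ (-a + 3 / 2) = K1 at *
  generalize (k : ℝ) ^ a = K2 at *
  generalize (k : ℝ) ^ (1 / 2 : ℝ) = K3 at *
  generalize (k : ℝ) ^ (1 : ℝ) = K4 at *
  field_simp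
  linear_combination hp

open Topology in
/-- Asymptotics of the Green function at the origin, `α < 0`. -/
theorem tendsto_green_zero_of_neg {a l : ℝ} (ha : 0 < a) (ha1 : a ≤ 1 / 2) (hl : 0 < l) :
    Tendsto (fun m : ℕ => green (-a) (Real.exp (-(l / m))) 0 0 / (m : ℝ) ^ a) atTop
      (𝓝 (Real.Gamma (-a + 3 / 2) * Real.Gamma a / Real.Gamma (1 / 2) * (2 * l) ^ (-a))) := by
  simp_rw [green_zero_zero (show -1 / 2 ≤ -a by linarith), exp_neg_div_sq]
  have hl2 : 0 < 2 * l := by linarith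
  have hb : ∀ k : ℕ, 0 < (∏ j ∈ Finset.range k, (a + (j : ℝ))) / k.factorial := fun k =>
    div_pos (pochhammer_pos ha k) (by exact_mod_cast Nat.factorial_pos k)
  refine tendsto_powerSeries_div (fun k => (hb k).le)
    (fun v hv0 hv1 => (hasSum_binomial a hv0 hv1).summable)
    (abs_sub_le_of_tendsto_div (Eventually.of_forall hb) (tendsto_pochhammer_ratio ha (by linarith)))
    ((exp_neg_div_mem hl2).mono fun m hm => ⟨hm.1.le, hm.2⟩)
    ((tendsto_rpow_atTop ha).comp tendsto_natCast_atTop_atTop) ?_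
  -- The comparison series is `(1 - w) ^ (-a)`, and `(m (1 - w)) ^ (-a) → (2 l) ^ (-a)`; the 2 comes
  -- from `w = z²`.
  have h1 := (tendsto_mul_one_sub_exp_neg_div (2 * l)).rpow_const (p := -a) (Or.inl hl2.ne')
  refine h1.congr' ?_
  filter_upwards [exp_neg_div_mem hl2, eventually_gt_atTop 0] with m hm hm0
  rw [(hasSum_binomial a hm.1.le hm.2).tsum_eq, Real.mul_rpow (Nat.cast_nonneg m) (by linarith [hm.2]),
    Real.rpow_neg (Nat.cast_nonneg m), div_eq_inv_mul (_ ^ (-a))]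

open Topology in
/-- Asymptotics of the Green function at the origin, `α = 0`. -/
theorem tendsto_green_zero_of_zero {l : ℝ} (hl : 0 < l) :
    Tendsto (fun m : ℕ => green 0 (Real.exp (-(l / m))) 0 0 / Real.log m) atTop
      (𝓝 (1 / 2)) := by
  simp_rw [green_zero_zero (show (-1 / 2 : ℝ) ≤ 0 by norm_num), exp_neg_div_sq]
  have hl2 : 0 < 2 * l := by linarith
  -- For `α = 0` the two Pochhammer products differ by a shift of 1, so their quotient telescopes.
  have hr : ∀ k : ℕ, (∏ j ∈ Finset.range k, (1 / 2 + (j : ℝ))) /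
      (∏ j ∈ Finset.range k, (0 + 3 / 2 + (j : ℝ))) = 1 / (2 * k + 1) := by
    intro k
    have h3 : (2 * (k : ℝ) + 1) ≠ 0 := by positivity
    rw [div_eq_div_iff (pochhammer_pos (by norm_num) k).ne' h3]
    induction k with
    | zero => simp
    | succ k ih =>
      have ih := ih (by positivity)
      rw [Finset.prod_range_succ, Finset.prod_range_succ]
      push_cast
      linear_combination (3 / 2 + (k : ℝ)) * ih
  simp_rw [hr]
  -- The coefficient `1 / k` is 0 at `k = 0`, so the series needs no shift.
  have hlog : ∀ v : ℝ, 0 ≤ v → v < 1 → HasSum (fun k : ℕ => 1 / (k : ℝ) * v ^ k) (-Real.log (1 - v)) := by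
    intro v hv0 hv1
    have := Real.hasSum_pow_div_log_of_abs_lt_one (x := v) (by rwa [abs_of_nonneg hv0])
    rw [← hasSum_nat_add_iff' 1]
    simp only [Finset.range_one, Finset.sum_singleton, Nat.cast_zero, div_zero, zero_mul, sub_zero]
    refine this.congr_fun fun k => ?_
    push_cast; ring
  have hlogm : Tendsto (fun m : ℕ => Real.log m) atTop atTop :=
    Real.tendsto_log_atTop.comp tendsto_natCast_atTop_atTop
  have hratio : Tendsto (fun k : ℕ => (1 / (2 * (k : ℝ) + 1)) / (1 / (k : ℝ))) atTop (𝓝 (1 / 2)) := by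
    have h1 : Tendsto (fun k : ℕ => (1 : ℝ) / (2 + 1 / (k : ℝ))) atTop (𝓝 (1 / (2 + 0))) :=
      tendsto_const_nhds.div (tendsto_const_nhds.add tendsto_one_div_atTop_nhds_zero_nat) (by norm_num)
    rw [add_zero] at h1
    refine h1.congr' ?_
    filter_upwards [eventually_gt_atTop 0] with k hk
    have hk' : (0 : ℝ) < k := by exact_mod_cast hk
    field_simp
  have := tendsto_powerSeries_div (a := fun k : ℕ => 1 / (2 * (k : ℝ) + 1))
    (b := fun k : ℕ => 1 / (k : ℝ)) (c := 1 / 2) (d := 1)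
    (w := fun m : ℕ => Real.exp (-(2 * l / m))) (L := fun m : ℕ => Real.log m)
    (fun k => by positivity) (fun v hv0 hv1 => (hlog v hv0 hv1).summable)
    (abs_sub_le_of_tendsto_div (by
      filter_upwards [eventually_gt_atTop 0] with k hk
      have hk' : (0 : ℝ) < k := by exact_mod_cast hk
      positivity) hratio)
    ((exp_neg_div_mem hl2).mono fun m hm => ⟨hm.1.le, hm.2⟩) hlogm ?_
  · simpa using this
  · have h1 := (tendsto_mul_one_sub_exp_neg_div (2 * l)).log hl2.ne'
    have h2 : Tendsto (fun m : ℕ => 1 - Real.log (m * (1 - Real.exp (-(2 * l / m)))) / Real.log m)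
        atTop (𝓝 (1 - 0)) := tendsto_const_nhds.sub (h1.div_atTop hlogm)
    rw [sub_zero] at h2
    refine h2.congr' ?_
    filter_upwards [exp_neg_div_mem hl2, eventually_gt_atTop 1] with m hm hm1
    have hm0 : (0 : ℝ) < m := by positivity
    have hlm : 0 < Real.log m := Real.log_pos (by exact_mod_cast hm1)
    rw [(hlog _ hm.1.le hm.2).tsum_eq, Real.log_mul hm0.ne' (by linarith [hm.2])]
    field_simp
    ring

/-! ### The generating function of the local time -/

/-- The generating function `E_x[ρ ^ Nₙ(y)]` of the local time, defined by its recursion. -/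
noncomputable def localTimePgf (α ρ : ℝ) (y : ℕ) : ℕ → ℕ → ℝ
  | 0, x => if x = y then ρ else 1
  | n + 1, x => (if x = y then ρ else 1) * (gegenbauerUp α x * localTimePgf α ρ y n (x + 1) +
      gegenbauerDown α x * localTimePgf α ρ y n (x - 1))

theorem localTimePgf_nonneg {α ρ : ℝ} (hα : -1 / 2 ≤ α) (hρ0 : 0 ≤ ρ) (y n x : ℕ) : 0 ≤ localTimePgf α ρ y n x := by
  have hr : ∀ x, 0 ≤ if x = y then ρ else 1 := fun x => by split_ifs <;> linarith
  induction n generalizing x with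
  | zero => exact hr x
  | succ n ih =>
    exact mul_nonneg (hr x) (add_nonneg (mul_nonneg (gegenbauerUp_pos hα x).le (ih _))
      (mul_nonneg (gegenbauerDown_nonneg hα x) (ih _)))

/-- This monotonicity is the Tauberian condition. The recursion preserves order, so it is enough to
compare times 0 and 1. -/
theorem localTimePgf_antitone {α ρ : ℝ} (hα : -1 / 2 ≤ α) (hρ0 : 0 ≤ ρ) (hρ1 : ρ ≤ 1) (y x : ℕ) :
    Antitone fun n => localTimePgf α ρ y n x := by
  have hr0 : ∀ x, 0 ≤ if x = y then ρ else 1 := fun x => by split_ifs <;> linarith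
  have hr1 : ∀ x, (if x = y then ρ else 1) ≤ 1 := fun x => by split_ifs <;> linarith
  refine antitone_nat_of_succ_le fun n => ?_
  induction n generalizing x with
  | zero =>
    refine mul_le_of_le_one_right (hr0 x) ?_
    have h1 := mul_le_mul_of_nonneg_left (hr1 (x + 1)) (gegenbauerUp_pos hα x).le
    have h2 := mul_le_mul_of_nonneg_left (hr1 (x - 1)) (gegenbauerDown_nonneg hα x)
    have h3 := gegenbauerUp_add_down hα x
    simp only [localTimePgf]
    linarith
  | succ n ih =>
    exact mul_le_mul_of_nonneg_left (add_le_add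
      (mul_le_mul_of_nonneg_left (ih _) (gegenbauerUp_pos hα x).le)
      (mul_le_mul_of_nonneg_left (ih _) (gegenbauerDown_nonneg hα x))) (hr0 x)

theorem localTimePgf_le_one {α ρ : ℝ} (hα : -1 / 2 ≤ α) (hρ0 : 0 ≤ ρ) (hρ1 : ρ ≤ 1) (y n x : ℕ) :
    localTimePgf α ρ y n x ≤ 1 := by
  refine (localTimePgf_antitone hα hρ0 hρ1 y x (Nat.zero_le n)).trans ?_
  simp only [localTimePgf]
  split_ifs <;> linarith

theorem summable_localTimePgf {α ρ z : ℝ} (hα : -1 / 2 ≤ α) (hρ0 : 0 ≤ ρ) (hρ1 : ρ ≤ 1)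
    (hz0 : 0 ≤ z) (hz1 : z < 1) (y x : ℕ) :
    Summable fun n => z ^ n * localTimePgf α ρ y n x :=
  Summable.of_nonneg_of_le
    (fun n => mul_nonneg (pow_nonneg hz0 n) (localTimePgf_nonneg hα hρ0 y n x))
    (fun n => mul_le_of_le_one_right (pow_nonneg hz0 n) (localTimePgf_le_one hα hρ0 hρ1 y n x))
    (summable_geometric_of_lt_one hz0 hz1)

/-- Uniqueness of bounded solutions of the discounted equation. -/
theorem eq_zero_of_bounded_of_discounted {α z B : ℝ} (hα : -1 / 2 ≤ α) (hz0 : 0 ≤ z) (hz1 : z < 1)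
    {r D : ℕ → ℝ} (hr0 : ∀ x, 0 ≤ r x) (hr1 : ∀ x, r x ≤ 1) (hB : ∀ x, |D x| ≤ B)
    (hD : ∀ x, D x = r x * (z * (gegenbauerUp α x * D (x + 1) + gegenbauerDown α x * D (x - 1))))
    (x : ℕ) : D x = 0 := by
  -- Each use of the equation gains a factor `z`, because the two step weights average and `r ≤ 1`.
  have hn : ∀ n x, |D x| ≤ z ^ n * B := by
    intro n
    induction n with
    | zero => simpa using hB
    | succ n ih =>
      intro x
      have hC : 0 ≤ z ^ n * B := (abs_nonneg _).trans (ih x)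
      have h1 : |gegenbauerUp α x * D (x + 1) + gegenbauerDown α x * D (x - 1)| ≤ z ^ n * B := by
        refine (abs_add_le _ _).trans ?_
        rw [abs_mul, abs_mul, abs_of_pos (gegenbauerUp_pos hα x),
          abs_of_nonneg (gegenbauerDown_nonneg hα x)]
        have h1 := mul_le_mul_of_nonneg_left (ih (x + 1)) (gegenbauerUp_pos hα x).le
        have h2 := mul_le_mul_of_nonneg_left (ih (x - 1)) (gegenbauerDown_nonneg hα x)
        have h3 := gegenbauerUp_add_down hα x
        have h4 : gegenbauerUp α x * (z ^ n * B) + gegenbauerDown α x * (z ^ n * B) = z ^ n * B := by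
          rw [← add_mul, h3, one_mul]
        linarith
      rw [hD x, abs_mul, abs_of_nonneg (hr0 x), abs_mul, abs_of_nonneg hz0]
      have h2 := mul_le_mul_of_nonneg_left h1 hz0
      calc _ ≤ z * |gegenbauerUp α x * D (x + 1) + gegenbauerDown α x * D (x - 1)| :=
            mul_le_of_le_one_left (mul_nonneg hz0 (abs_nonneg _)) (hr1 x)
        _ ≤ z * (z ^ n * B) := h2
        _ = z ^ (n + 1) * B := by ring
  have hlim : Tendsto (fun n : ℕ => z ^ n * B) atTop (nhds (0 * B)) :=
    (tendsto_pow_atTop_nhds_zero_of_lt_one hz0 hz1).mul_const B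
  rw [zero_mul] at hlim
  have := ge_of_tendsto' hlim fun n => hn n x
  exact abs_nonpos_iff.1 this

/-- The discounted sum of the generating functions of the local time through the Green function. -/
theorem tsum_localTimePgf {α ρ z : ℝ} (hα : -1 / 2 ≤ α) (hρ0 : 0 < ρ) (hρ1 : ρ ≤ 1) (hz0 : 0 ≤ z)
    (hz1 : z < 1) (x y : ℕ) :
    ∑' n, z ^ n * localTimePgf α ρ y n x =
      (1 - z)⁻¹ * (1 - (1 - ρ) * green α z x y / (ρ + (1 - ρ) * green α z y y)) := by
  set U : ℕ → ℝ := fun x => ∑' n, z ^ n * localTimePgf α ρ y n x with hU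
  have hg0 : ∀ x, 0 ≤ green α z x y := fun x => green_nonneg hα hz0 x y
  set E := ρ + (1 - ρ) * green α z y y with hE
  have hE0 : 0 < E := by
    have := mul_nonneg (sub_nonneg.2 hρ1) (hg0 y)
    linarith
  -- Away from `y`, any affine function `(1 - z)⁻¹ (1 - b G_z(·, y))` solves the equation of `U`;
  -- the value `b = (1 - ρ) / E` is the one that also satisfies it at `y`.
  set V : ℕ → ℝ := fun x => (1 - z)⁻¹ * (1 - (1 - ρ) * green α z x y / E) with hV
  have hz1' : 1 - z ≠ 0 := by linarith
  have hzi : 0 < (1 - z)⁻¹ := inv_pos.2 (by linarith)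
  have hs := summable_localTimePgf hα hρ0.le hρ1 hz0 hz1 y
  have hUeq : ∀ x, U x = (if x = y then ρ else 1) * (1 + z * (gegenbauerUp α x * U (x + 1) +
      gegenbauerDown α x * U (x - 1))) := by
    intro x
    simp only [hU]
    rw [(hs x).tsum_eq_zero_add, ← tsum_mul_left, ← tsum_mul_left,
      ← ((hs (x + 1)).mul_left _).tsum_add ((hs (x - 1)).mul_left _), ← tsum_mul_left, mul_add,
      ← tsum_mul_left]
    congr 1
    · simp [localTimePgf]
    · refine tsum_congr fun n => ?_
      simp only [localTimePgf]; ring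
  have hVeq : ∀ x, V x = (if x = y then ρ else 1) * (1 + z * (gegenbauerUp α x * V (x + 1) +
      gegenbauerDown α x * V (x - 1))) := by
    intro x
    have hge := green_eq hα hz0 hz1 x y
    have hud := gegenbauerUp_add_down hα x
    have hPV : z * (gegenbauerUp α x * V (x + 1) + gegenbauerDown α x * V (x - 1)) =
        (1 - z)⁻¹ * (z - (1 - ρ) / E * (green α z x y - if x = y then 1 else 0)) := by
      have : green α z x y - (if x = y then 1 else 0) = z * (gegenbauerUp α x * green α z (x + 1) y +
        gegenbauerDown α x * green α z (x - 1) y) := by linarith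
      rw [this]
      simp only [hV]
      linear_combination (z * (1 - z)⁻¹) * hud
    rw [hPV]
    by_cases hxy : x = y
    · subst hxy
      simp only [hV, if_true]
      have hEg : (1 - ρ) * green α z x x = E - ρ := by rw [hE]; ring
      field_simp
      linear_combination (-(1 - ρ)) * hEg
    · simp only [hV, if_neg hxy]
      field_simp
      ring
  have hUb : ∀ x, |U x| ≤ (1 - z)⁻¹ := by
    intro x
    have h0 : 0 ≤ U x := tsum_nonneg fun n =>
      mul_nonneg (pow_nonneg hz0 n) (localTimePgf_nonneg hα hρ0.le y n x)
    rw [abs_of_nonneg h0, ← tsum_geometric_of_lt_one hz0 hz1]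
    exact (hs x).tsum_le_tsum (fun n => mul_le_of_le_one_right (pow_nonneg hz0 n)
      (localTimePgf_le_one hα hρ0.le hρ1 y n x)) (summable_geometric_of_lt_one hz0 hz1)
  have hVb : ∀ x, |V x| ≤ (1 - z)⁻¹ * (1 + (1 - z)⁻¹ / E) := by
    intro x
    simp only [hV]
    rw [abs_mul, abs_of_pos hzi]
    refine mul_le_mul_of_nonneg_left ?_ hzi.le
    refine (abs_sub _ _).trans ?_
    have h1 : 0 ≤ (1 - ρ) * green α z x y / E :=
      div_nonneg (mul_nonneg (by linarith) (hg0 x)) hE0.le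
    rw [abs_one, abs_of_nonneg h1]
    gcongr
    calc (1 - ρ) * green α z x y ≤ 1 * green α z x y :=
          mul_le_mul_of_nonneg_right (by linarith) (hg0 x)
      _ ≤ (1 - z)⁻¹ := by rw [one_mul]; exact green_le hα hz0 hz1 x y
  have := eq_zero_of_bounded_of_discounted hα hz0 hz1 (r := fun x => if x = y then ρ else 1)
    (D := fun x => U x - V x) (B := (1 - z)⁻¹ + (1 - z)⁻¹ * (1 + (1 - z)⁻¹ / E))
    (fun x => by split_ifs <;> linarith) (fun x => by split_ifs <;> linarith)
    (fun x => (abs_sub _ _).trans (add_le_add (hUb x) (hVb x)))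
    (fun x => by rw [hUeq x, hVeq x]; ring) x
  exact sub_eq_zero.1 this

-- In the closed form, `L (1 - ρ) → s`, `G / L → c` and `m (1 - z) → l`, so the bracket tends to `1
-- - s c / (1 + s c)`. The hypothesis is needed at `x` and at `y`, the two starting points that
-- occur there.
open Topology in
theorem tendsto_tsum_localTimePgf {α l s c : ℝ} (hα : -1 / 2 ≤ α) (hl : 0 < l) (hs : 0 ≤ s)
    (hc : 0 ≤ c) {L : ℕ → ℝ} (hL : Tendsto L atTop atTop) (x y : ℕ)
    (hg : ∀ x, Tendsto (fun m : ℕ => green α (Real.exp (-(l / m))) x y / L m) atTop (𝓝 c)) :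
    Tendsto (fun m : ℕ => (m : ℝ)⁻¹ *
        ∑' n : ℕ, Real.exp (-(l * (n / m))) * localTimePgf α (Real.exp (-(s / L m))) y n x) atTop
      (𝓝 (l⁻¹ * (1 + s * c)⁻¹)) := by
  have h1 := tendsto_mul_one_sub_exp_neg_div_of_atTop s hL
  have h2 := tendsto_exp_neg_div s hL
  have hsc : 0 < 1 + s * c := by positivity
  have h3 := (((tendsto_const_nhds (x := (1 : ℝ))).sub ((h1.mul (hg x)).div
    (h2.add (h1.mul (hg y))) hsc.ne')).const_mul l⁻¹)
  have e : l⁻¹ * (1 - s * c / (1 + s * c)) = l⁻¹ * (1 + s * c)⁻¹ := by field_simp; ring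
  rw [e] at h3
  have h4 := ((tendsto_mul_one_sub_exp_neg_div l).inv₀ hl.ne').mul (h3.const_mul l)
  have e' : l⁻¹ * (l * (l⁻¹ * (1 + s * c)⁻¹)) = l⁻¹ * (1 + s * c)⁻¹ := by field_simp
  rw [e'] at h4
  refine h4.congr' ?_
  filter_upwards [exp_neg_div_mem hl, hL.eventually_gt_atTop 0, eventually_gt_atTop 0]
    with m hm hLm hm0
  have hm' : (0 : ℝ) < m := by exact_mod_cast hm0
  have hρ1 : Real.exp (-(s / L m)) ≤ 1 := by
    rw [Real.exp_le_one_iff]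
    have : 0 ≤ s / L m := by positivity
    linarith
  have hz : ∀ n : ℕ, Real.exp (-(l * (n / m))) = Real.exp (-(l / m)) ^ n := by
    intro n; rw [← Real.exp_nat_mul]; congr 1; ring
  simp_rw [hz]
  rw [tsum_localTimePgf hα (Real.exp_pos _) hρ1 hm.1.le hm.2]
  have hz1 : 1 - Real.exp (-(l / m)) ≠ 0 := by linarith [hm.2]
  have ex : ∀ x, L m * (1 - Real.exp (-(s / L m))) * (green α (Real.exp (-(l / m))) x y / L m) =
      (1 - Real.exp (-(s / L m))) * green α (Real.exp (-(l / m))) x y := by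
    intro x; field_simp
  simp only [Pi.div_apply]
  rw [ex, ex]
  rw [mul_inv]
  field_simp

/-! ### The limiting constant and the limits of the generating functions -/

theorem gegenbauerWeight_pos {α : ℝ} (hα : -1 / 2 ≤ α) (y : ℕ) : 0 < gegenbauerWeight α y := by
  rcases y with _ | y
  · rw [gegenbauerWeight_zero]
    exact Real.Gamma_pos_of_pos (by linarith)
  · rw [gegenbauerWeight_succ hα]
    have : (0 : ℝ) ≤ y := y.cast_nonneg
    exact mul_pos (gegenbauer_den_pos hα y) (Real.Gamma_pos_of_pos (by linarith))

/-- Legendre's duplication formula at `1 - a` reconciles the constant produced by the Green function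
with the stated scale. -/
theorem limitScale_neg_eq {a : ℝ} (ha : 0 < a) (ha1 : a ≤ 1 / 2) (y : ℕ) :
    limitScale (-a) y = gegenbauerInvariant (-a) y *
      (Real.Gamma (-a + 3 / 2) * Real.Gamma a / Real.Gamma (1 / 2) * 2 ^ (-a)) := by
  have hd := Real.Gamma_mul_Gamma_add_half (1 - a)
  rw [show 1 - a + 1 / 2 = -a + 3 / 2 by ring, show 2 * (1 - a) = 2 * -a + 2 by ring,
    show 1 - (2 * -a + 2) = -(-a + (-a + 1)) by ring, Real.rpow_neg (by norm_num),
    Real.rpow_add (by norm_num), show 1 - a = -a + 1 by ring] at hd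
  unfold limitScale gegenbauerInvariant
  rw [abs_neg, abs_of_pos ha, Real.Gamma_one_half_eq]
  have h1 : 0 < Real.Gamma (2 * -a + 2) := Real.Gamma_pos_of_pos (by linarith)
  have h2 : 0 < Real.Gamma ((y : ℝ) + 1) := Real.Gamma_pos_of_pos (by positivity)
  have h3 : 0 < Real.Gamma (-a + 1) := Real.Gamma_pos_of_pos (by linarith)
  have h4 : 0 < √Real.pi := Real.sqrt_pos.2 Real.pi_pos
  have h5 : (0 : ℝ) < 2 ^ (-a) := by positivity
  have h6 : (0 : ℝ) < 2 ^ (-a + 1) := by positivity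
  generalize Real.Gamma (2 * -a + 2) = G1 at *
  generalize Real.Gamma ((y : ℝ) + 1) = G2 at *
  generalize Real.Gamma (-a + 1) = G3 at *
  generalize Real.Gamma (-a + 3 / 2) = G4 at *
  generalize √Real.pi = G5 at *
  generalize (2 : ℝ) ^ (-a) = G6 at *
  generalize (2 : ℝ) ^ (-a + 1) = G7 at *
  generalize gegenbauerWeight (-a) y = W
  generalize Real.Gamma a = G8
  field_simp at hd ⊢
  linear_combination (-W * G8) * hd

theorem limitScale_neg_pos {a : ℝ} (ha : 0 < a) (ha1 : a ≤ 1 / 2) (y : ℕ) :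
    0 < limitScale (-a) y := by
  unfold limitScale
  rw [abs_neg, abs_of_pos ha]
  have := gegenbauerWeight_pos (show -1 / 2 ≤ -a by linarith) y
  have h1 : 0 < Real.Gamma a := Real.Gamma_pos_of_pos ha
  have h2 : 0 < Real.Gamma ((y : ℝ) + 1) := Real.Gamma_pos_of_pos (by positivity)
  have h3 : 0 < Real.Gamma (-a + 1) := Real.Gamma_pos_of_pos (by linarith)
  positivity

open Topology in
/-- Laplace transforms of the normalized local times converge, `α = -a < 0`. -/
theorem tendsto_localTimePgf_of_neg {a s : ℝ} (ha : 0 < a) (ha1 : a ≤ 1 / 2) (hs : 0 ≤ s)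
    (x y : ℕ) :
    Tendsto (fun m : ℕ => localTimePgf (-a) (Real.exp (-(s / (m : ℝ) ^ a))) y m x) atTop
      (𝓝 (mittagLeffler a (-(s * limitScale (-a) y)))) := by
  have hα : -1 / 2 ≤ -a := by linarith
  set C := limitScale (-a) y with hC
  have hC0 : 0 < C := limitScale_neg_pos ha ha1 y
  set κ := s * C with hκ
  have hκ0 : 0 ≤ κ := by positivity
  have hL : Tendsto (fun m : ℕ => (m : ℝ) ^ a) atTop atTop :=
    (tendsto_rpow_atTop ha).comp tendsto_natCast_atTop_atTop
  -- Then `κ l⁻ᵃ = κ / (κ + 1) < 1`, and larger values `l + k` only decrease it.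
  set l := (κ + 1) ^ (1 / a) with hl
  have hl0 : 0 < l := by positivity
  have hla : κ * (l⁻¹) ^ a < 1 := by
    rw [Real.inv_rpow hl0.le, hl, ← Real.rpow_mul (by positivity), one_div_mul_cancel ha.ne',
      Real.rpow_one, ← div_eq_mul_inv, div_lt_one (by positivity)]
    linarith
  have hlk : ∀ k : ℕ, 0 < l + k := fun k => by positivity
  have hlka : ∀ k : ℕ, κ * ((l + k)⁻¹) ^ a < 1 := by
    intro k
    refine lt_of_le_of_lt (mul_le_mul_of_nonneg_left (Real.rpow_le_rpow (inv_pos.2 (hlk k)).le ?_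
      ha.le) hκ0) hla
    exact inv_anti₀ hl0 (by linarith [(Nat.cast_nonneg k : (0 : ℝ) ≤ k)])
  have hρ1 : ∀ m : ℕ, Real.exp (-(s / (m : ℝ) ^ a)) ≤ 1 := by
    intro m
    rw [Real.exp_le_one_iff]
    have : 0 ≤ s / (m : ℝ) ^ a := by positivity
    linarith
  have hcont : ContinuousAt (fun t : ℝ => mittagLeffler a (-(κ * t ^ a))) 1 := by
    refine (continuous_mittagLeffler ha).continuousAt.comp ?_
    exact ((Real.continuousAt_rpow_const 1 a (Or.inl one_ne_zero)).const_mul κ).neg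
  have key := tendsto_diag_of_abel_sum
    (h := fun m n => localTimePgf (-a) (Real.exp (-(s / (m : ℝ) ^ a))) y n x)
    (fun m => localTimePgf_antitone hα (Real.exp_pos _).le (hρ1 m) y x)
    (fun m n => localTimePgf_nonneg hα (Real.exp_pos _).le y n x)
    (fun m n => localTimePgf_le_one hα (Real.exp_pos _).le (hρ1 m) y n x)
    hl0 (laplace_mittagLeffler ha hκ0 hl0 hla).1 hcont ?_
  · simpa using key
  · intro k
    rw [(laplace_mittagLeffler ha hκ0 (hlk k) (hlka k)).2]
    have hg : ∀ x, Tendsto (fun m : ℕ => green (-a) (Real.exp (-((l + k) / m))) x y / (m : ℝ) ^ a)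
        atTop (𝓝 (C * ((l + k)⁻¹) ^ a)) := by
      intro x
      have := tendsto_green hα (exp_neg_div_mem (hlk k))
        (tendsto_exp_neg_div (l + k) tendsto_natCast_atTop_atTop) hL
        (tendsto_green_zero_of_neg ha ha1 (hlk k)) x y
      convert this using 2
      rw [hC, limitScale_neg_eq ha ha1, Real.mul_rpow (by norm_num) (hlk k).le,
        Real.inv_rpow (hlk k).le, Real.rpow_neg (hlk k).le]
      ring
    have := tendsto_tsum_localTimePgf hα (hlk k) hs (by positivity) hL x y hg
    rwa [← mul_assoc] at this

open Topology in
/-- Laplace transforms of the normalized local times converge, `α = 0`. -/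
theorem tendsto_localTimePgf_of_zero {s : ℝ} (hs : 0 ≤ s) (x y : ℕ) :
    Tendsto (fun m : ℕ => localTimePgf 0 (Real.exp (-(s / Real.log m))) y m x) atTop
      (𝓝 ((1 + s * ((2 * y + 1) / 2))⁻¹)) := by
  have hα : (-1 / 2 : ℝ) ≤ 0 := by norm_num
  have hL : Tendsto (fun m : ℕ => Real.log m) atTop atTop :=
    Real.tendsto_log_atTop.comp tendsto_natCast_atTop_atTop
  have hρ1 : ∀ m : ℕ, Real.exp (-(s / Real.log m)) ≤ 1 := by
    intro m
    rw [Real.exp_le_one_iff]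
    have : 0 ≤ s / Real.log m := div_nonneg hs (Real.log_natCast_nonneg m)
    linarith
  have hint : ∀ l : ℝ, 0 < l → IntegrableOn (fun t => Real.exp (-(l * t))) (Set.Ioi 0) := by
    intro l hl
    simpa [neg_mul] using exp_neg_integrableOn_Ioi 0 hl
  -- The limit profile is constant in time because the asymptotics of the Green function over `log
  -- m` do not depend on `l`; any `l > 0` would do.
  have key := tendsto_diag_of_abel_sum
    (h := fun m n => localTimePgf 0 (Real.exp (-(s / Real.log m))) y n x)
    (ψ := fun _ => (1 + s * ((2 * y + 1) / 2))⁻¹)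
    (fun m => localTimePgf_antitone hα (Real.exp_pos _).le (hρ1 m) y x)
    (fun m n => localTimePgf_nonneg hα (Real.exp_pos _).le y n x)
    (fun m n => localTimePgf_le_one hα (Real.exp_pos _).le (hρ1 m) y n x)
    one_pos ((hint 1 one_pos).mul_const _) continuousAt_const ?_
  · exact key
  · intro k
    have hlk : (0 : ℝ) < 1 + k := by positivity
    have e : ∫ t in Set.Ioi (0 : ℝ), Real.exp (-((1 + k) * t)) * (1 + s * ((2 * y + 1) / 2))⁻¹
        = (1 + (k : ℝ))⁻¹ * (1 + s * ((2 * y + 1) / 2))⁻¹ := by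
      have := integral_exp_mul_Ioi (a := -(1 + (k : ℝ))) (by linarith) 0
      simp only [neg_mul] at this
      rw [integral_mul_const, this, mul_zero, neg_zero, Real.exp_zero, neg_div_neg_eq, one_div]
    rw [e]
    refine tendsto_tsum_localTimePgf hα hlk hs (by positivity) hL x y fun x => ?_
    have := tendsto_green hα (exp_neg_div_mem hlk)
      (tendsto_exp_neg_div (1 + k) tendsto_natCast_atTop_atTop) hL
      (tendsto_green_zero_of_zero hlk) x y
    convert this using 2
    unfold gegenbauerInvariant gegenbauerWeight
    have hy : (0 : ℝ) < 2 * y + 2 * 0 + 1 := by positivity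
    have hG : Real.Gamma ((y : ℝ) + 1) ≠ 0 := (Real.Gamma_pos_of_pos (by positivity)).ne'
    have h2 : Real.Gamma (2 * 0 + 2) = 1 := by norm_num [Real.Gamma_two]
    rw [if_neg hy.ne', h2, mul_zero, add_zero, add_zero]
    field_simp

/-! ### From the Markov property to the recursion -/

open scoped ENNReal

/-- The one-step Markov property in integrated form. -/
theorem IsMarkovChainFrom.lintegral_step {Ω : Type*} [MeasurableSpace Ω] {p : ℕ → ℕ → ℝ} {x : ℕ}
    {P : Measure Ω} {S : ℕ → Ω → ℕ} (hS : IsMarkovChainFrom p x P S) (n : ℕ)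
    (F : (Fin (n + 1) → ℕ) → ℝ≥0∞) (φ : ℕ → ℝ≥0∞) :
    ∫⁻ ω, F (fun k => S k ω) * φ (S (n + 1) ω) ∂P =
      ∫⁻ ω, F (fun k => S k ω) * ∑' j, ENNReal.ofReal (p (S n ω) j) * φ j ∂P := by
  have hY : Measurable fun ω => (fun k : Fin (n + 1) => S k ω) :=
    measurable_pi_iff.2 fun k => hS.measurable k
  have hYS : Measurable fun ω => ((fun k : Fin (n + 1) => S k ω), S (n + 1) ω) :=
    hY.prodMk (hS.measurable (n + 1))
  have h1 := lintegral_map (μ := P) (f := fun q : (Fin (n + 1) → ℕ) × ℕ => F q.1 * φ q.2)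
    (Measurable.of_discrete) hYS
  have h2 := lintegral_map (μ := P) (f := fun s : Fin (n + 1) → ℕ =>
    F s * ∑' j, ENNReal.ofReal (p (s (Fin.last n)) j) * φ j) (Measurable.of_discrete) hY
  simp only [Fin.val_last] at h2
  rw [← h1, ← h2, lintegral_countable', lintegral_countable', ENNReal.tsum_prod']
  refine tsum_congr fun s => ?_
  have h3 : ∀ j, P.map (fun ω => ((fun k : Fin (n + 1) => S k ω), S (n + 1) ω)) {(s, j)} =
      P.map (fun ω => (fun k : Fin (n + 1) => S k ω)) {s} *
        ENNReal.ofReal (p (s (Fin.last n)) j) := by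
    intro j
    rw [Measure.map_apply hYS (measurableSet_singleton _),
      Measure.map_apply hY (measurableSet_singleton _)]
    -- The finite path `s` is prolonged by `j`; values after time `n + 1` play no role.
    have := hS.markov n (fun k => if h : k < n + 1 then s ⟨k, h⟩ else j)
    simp only [lt_add_iff_pos_right, zero_lt_one, lt_irrefl, dif_pos, dif_neg,
      not_false_eq_true] at this
    have hlast : s ⟨n, Nat.lt_succ_self n⟩ = s (Fin.last n) := rfl
    rw [hlast] at this
    convert this using 2
    · ext ω
      simp only [Set.mem_preimage, Set.mem_singleton_iff, Prod.mk.injEq, Set.mem_ofPred_eq]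
      constructor
      · rintro ⟨ha, hb⟩ k hk
        by_cases hkn : k < n + 1
        · rw [dif_pos hkn, ← congrFun ha ⟨k, hkn⟩]
        · obtain rfl : k = n + 1 := by omega
          rw [dif_neg hkn, hb]
      · intro h
        refine ⟨?_, ?_⟩
        · ext k
          have := h k (by omega)
          rwa [dif_pos k.2] at this
        · have := h (n + 1) le_rfl
          rwa [dif_neg (lt_irrefl _)] at this
    · congr 1
      ext ω
      simp only [Set.mem_preimage, Set.mem_singleton_iff, Set.mem_ofPred_eq]
      constructor
      · intro ha k hk
        rw [dif_pos (by omega), ← congrFun ha ⟨k, by omega⟩]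
      · intro h
        ext k
        have := h k (by omega)
        rwa [dif_pos k.2] at this
  simp_rw [h3]
  rw [← ENNReal.tsum_mul_left, ← ENNReal.tsum_mul_right]
  refine tsum_congr fun j => ?_
  ring

theorem tsum_gegenbauerTransition (α : ℝ) (x : ℕ) (φ : ℕ → ℝ≥0∞) :
    ∑' j, ENNReal.ofReal (gegenbauerTransition α x j) * φ j =
      ENNReal.ofReal (gegenbauerUp α x) * φ (x + 1) +
        ENNReal.ofReal (gegenbauerDown α x) * φ (x - 1) := by
  rcases x with _ | x
  · rw [tsum_eq_single 1]
    · simp [gegenbauerTransition]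
    · intro j hj
      simp [gegenbauerTransition, hj]
  · rw [tsum_eq_sum (s := {x + 2, x})]
    · rw [Finset.sum_pair (by omega)]
      have h1 : gegenbauerTransition α (x + 1) (x + 2) = gegenbauerUp α (x + 1) := by
        simp [gegenbauerTransition, gegenbauerUp]
      have h2 : gegenbauerTransition α (x + 1) x = gegenbauerDown α (x + 1) := by
        have h3 : ¬ (x = x + 1 + 1) := by omega
        simp [gegenbauerTransition, gegenbauerDown, h3]
      rw [h1, h2, Nat.add_sub_cancel]
    · intro j hj
      simp only [Finset.mem_insert, Finset.mem_singleton, not_or] at hj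
      have h1 : ¬ (j = x + 1 + 1) := hj.1
      simp [gegenbauerTransition, h1, hj.2]

theorem ofReal_localTimePgf_succ {α ρ : ℝ} (hα : -1 / 2 ≤ α) (hρ0 : 0 ≤ ρ) (y k x : ℕ) :
    ENNReal.ofReal (localTimePgf α ρ y (k + 1) x) =
      ENNReal.ofReal ρ ^ (if x = y then 1 else 0) *
        ∑' j, ENNReal.ofReal (gegenbauerTransition α x j) *
          ENNReal.ofReal (localTimePgf α ρ y k j) := by
  have h1 := mul_nonneg (gegenbauerUp_pos hα x).le (localTimePgf_nonneg hα hρ0 y k (x + 1))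
  have h2 := mul_nonneg (gegenbauerDown_nonneg hα x) (localTimePgf_nonneg hα hρ0 y k (x - 1))
  rw [tsum_gegenbauerTransition, ← ENNReal.ofReal_mul (gegenbauerUp_pos hα x).le,
    ← ENNReal.ofReal_mul (gegenbauerDown_nonneg hα x), ← ENNReal.ofReal_add h1 h2, localTimePgf]
  split_ifs <;> simp [ENNReal.ofReal_mul hρ0]

theorem IsMarkovChainFrom.measurable_localTime {Ω : Type*} [MeasurableSpace Ω] {p : ℕ → ℕ → ℝ}
    {x : ℕ} {P : Measure Ω} {S : ℕ → Ω → ℕ} (hS : IsMarkovChainFrom p x P S) (n y : ℕ) :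
    Measurable (localTime S n y) :=
  Finset.measurable_fun_sum _ fun i _ => (Measurable.of_discrete
    (f := fun k : ℕ => if k = y then 1 else 0)).comp (hS.measurable i)

/-- The generating function of the local time of a chain. -/
theorem integral_pow_localTime {α ρ : ℝ} (hα : -1 / 2 ≤ α) (hρ0 : 0 ≤ ρ)
    {Ω : Type*} [MeasurableSpace Ω] {x : ℕ} {P : Measure Ω} [IsProbabilityMeasure P]
    {S : ℕ → Ω → ℕ} (hS : IsMarkovChainFrom (gegenbauerTransition α) x P S) (y n : ℕ) :
    ∫ ω, ρ ^ localTime S n y ω ∂P = localTimePgf α ρ y n x := by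
  -- Interpolation: weigh the visits before time `n` explicitly and the remaining `k` steps by the
  -- recursive function at `S n`. The expectation depends only on `n + k`; `k = 0` is the local time
  -- and `n = 0` the recursion.
  have key : ∀ n k, ∫⁻ ω, ENNReal.ofReal ρ ^ (∑ i ∈ Finset.range n, if S i ω = y then 1 else 0) *
      ENNReal.ofReal (localTimePgf α ρ y k (S n ω)) ∂P =
        ENNReal.ofReal (localTimePgf α ρ y (n + k) x) := by
    intro n
    induction n with
    | zero =>
      intro k
      have : ∀ᵐ ω ∂P, ENNReal.ofReal ρ ^ (∑ i ∈ Finset.range 0, if S i ω = y then 1 else 0) *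
          ENNReal.ofReal (localTimePgf α ρ y k (S 0 ω)) =
          ENNReal.ofReal (localTimePgf α ρ y k x) := by
        filter_upwards [hS.start] with ω hω
        simp [hω]
      rw [lintegral_congr_ae this]
      simp
    | succ n ih =>
      intro k
      rw [show n + 1 + k = n + (k + 1) by ring, ← ih (k + 1)]
      have h := hS.lintegral_step n
        (fun s => ENNReal.ofReal ρ ^ (∑ i, if s i = y then 1 else 0))
        (fun j => ENNReal.ofReal (localTimePgf α ρ y k j))
      have hfin : ∀ ω, (∑ i : Fin (n + 1), if S i ω = y then 1 else 0) =
          ∑ i ∈ Finset.range (n + 1), if S i ω = y then 1 else 0 := fun ω =>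
        Fin.sum_univ_eq_sum_range (fun i => if S i ω = y then 1 else 0) (n + 1)
      simp only [hfin] at h
      rw [h]
      refine lintegral_congr fun ω => ?_
      rw [ofReal_localTimePgf_succ hα hρ0, Finset.sum_range_succ, pow_add, mul_assoc]
  have h0 : ∫⁻ ω, ENNReal.ofReal (ρ ^ localTime S n y ω) ∂P =
      ENNReal.ofReal (localTimePgf α ρ y n x) := by
    rw [← add_zero n, ← key n 0]
    refine lintegral_congr fun ω => ?_
    rw [add_zero, localTime, Finset.sum_range_succ, pow_add, ENNReal.ofReal_mul (pow_nonneg hρ0 _),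
      ENNReal.ofReal_pow hρ0]
    congr 2
    simp only [localTimePgf]
    split_ifs <;> simp
  rw [integral_eq_lintegral_of_nonneg_ae (ae_of_all _ fun ω => pow_nonneg hρ0 _)
    ((Measurable.of_discrete (f := fun k : ℕ => ρ ^ k)).comp
      (hS.measurable_localTime n y)).aestronglyMeasurable, h0,
    ENNReal.toReal_ofReal (localTimePgf_nonneg hα hρ0 y n x)]

/-! ### Existence and uniqueness of the Mittag-Leffler distribution -/

/-- The law of the local time `Nₙ(y)` from `x`, defined by its recursion. -/
noncomputable def localTimeLaw (α : ℝ) (y : ℕ) : ℕ → ℕ → Measure ℕ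
  | 0, x => Measure.dirac (if x = y then 1 else 0)
  | n + 1, x => ENNReal.ofReal (gegenbauerUp α x) •
        (localTimeLaw α y n (x + 1)).map (· + if x = y then 1 else 0) +
      ENNReal.ofReal (gegenbauerDown α x) •
        (localTimeLaw α y n (x - 1)).map (· + if x = y then 1 else 0)

theorem isProbabilityMeasure_localTimeLaw {α : ℝ} (hα : -1 / 2 ≤ α) (y n x : ℕ) :
    IsProbabilityMeasure (localTimeLaw α y n x) := by
  induction n generalizing x with
  | zero => rw [localTimeLaw]; infer_instance
  | succ n ih =>
    have h1 := ih (x + 1)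
    have h2 := ih (x - 1)
    constructor
    rw [localTimeLaw, Measure.add_apply, Measure.smul_apply, Measure.smul_apply,
      Measure.map_apply (Measurable.of_discrete) MeasurableSet.univ,
      Measure.map_apply (Measurable.of_discrete) MeasurableSet.univ]
    simp only [Set.preimage_univ, measure_univ, smul_eq_mul, mul_one]
    rw [← ENNReal.ofReal_add (gegenbauerUp_pos hα x).le (gegenbauerDown_nonneg hα x),
      gegenbauerUp_add_down hα, ENNReal.ofReal_one]

theorem integral_pow_localTimeLaw {α ρ : ℝ} (hα : -1 / 2 ≤ α) (hρ0 : 0 ≤ ρ) (hρ1 : ρ ≤ 1)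
    (y n x : ℕ) : ∫ k, ρ ^ k ∂(localTimeLaw α y n x) = localTimePgf α ρ y n x := by
  have hint : ∀ (μ : Measure ℕ), IsProbabilityMeasure μ → ∀ d : ℕ,
      Integrable (fun k => ρ ^ (k + d)) μ := by
    intro μ _ d
    refine Integrable.of_bound (Measurable.of_discrete.aestronglyMeasurable) 1
      (ae_of_all _ fun k => ?_)
    rw [Real.norm_of_nonneg (pow_nonneg hρ0 _)]
    exact pow_le_one₀ hρ0 hρ1
  induction n generalizing x with
  | zero =>
    rw [localTimeLaw, integral_dirac, localTimePgf]
    split_ifs <;> simp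
  | succ n ih =>
    have hP := isProbabilityMeasure_localTimeLaw hα y n
    have hmap : ∀ x' d, ∫ k, ρ ^ k ∂((localTimeLaw α y n x').map (· + d)) =
        ρ ^ d * localTimePgf α ρ y n x' := by
      intro x' d
      rw [integral_map (Measurable.of_discrete.aemeasurable)
        (Measurable.of_discrete.aestronglyMeasurable), ← ih, ← integral_const_mul]
      simp_rw [pow_add, mul_comm]
    have hi : ∀ x' d, Integrable (fun k => ρ ^ k) ((localTimeLaw α y n x').map (· + d)) := by
      intro x' d
      rw [integrable_map_measure (Measurable.of_discrete.aestronglyMeasurable)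
        (Measurable.of_discrete.aemeasurable)]
      exact hint _ (hP x') d
    rw [localTimeLaw, integral_add_measure ((hi _ _).smul_measure ENNReal.ofReal_ne_top)
      ((hi _ _).smul_measure ENNReal.ofReal_ne_top), integral_smul_measure, integral_smul_measure,
      hmap, hmap, localTimePgf, ENNReal.toReal_ofReal (gegenbauerUp_pos hα x).le,
      ENNReal.toReal_ofReal (gegenbauerDown_nonneg hα x)]
    simp only [smul_eq_mul]
    split_ifs <;> ring

theorem exp_neg_mul_natCast_div (s L : ℝ) (k : ℕ) :
    Real.exp (-s * ((k : ℝ) / L)) = Real.exp (-(s / L)) ^ k := by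
  rw [← Real.exp_nat_mul]; congr 1; ring

open Topology in
theorem tendsto_mittagLeffler_neg_mul {a : ℝ} (ha : 0 < a) (c : ℝ) :
    Tendsto (fun s => mittagLeffler a (-(s * c))) (𝓝[>] 0) (𝓝 1) := by
  have hc : Continuous fun s : ℝ => mittagLeffler a (-(s * c)) :=
    (continuous_mittagLeffler ha).comp (by fun_prop)
  have := (hc.tendsto 0).mono_left (nhdsWithin_le_nhds (s := Set.Ioi 0))
  simpa [mittagLeffler_zero] using this

theorem isMittagLeffler_iff {a : ℝ} (ha : 0 < a) (M : ProbabilityMeasure ℝ) :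
    IsMittagLeffler a M ↔ (∀ᵐ t ∂(M : Measure ℝ), 0 ≤ t) ∧
      ∀ s : ℝ, 0 ≤ s → ∫ t, Real.exp (-s * t) ∂(M : Measure ℝ) = mittagLeffler a (-s) := by
  refine and_congr_right fun _ => forall₂_congr fun s _ => ⟨fun h => h.tsum_eq.symm, fun h => ?_⟩
  rw [h]
  exact (summable_mittagLeffler ha (-s)).hasSum

/-- Existence and uniqueness of the Mittag-Leffler distribution. -/
theorem existsUnique_isMittagLeffler {a : ℝ} (ha : 0 < a) (ha1 : a ≤ 1 / 2) :
    ∃! M : ProbabilityMeasure ℝ, IsMittagLeffler a M := by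
  have hα : -1 / 2 ≤ -a := by linarith
  have hP := isProbabilityMeasure_localTimeLaw hα 0
  set c := limitScale (-a) 0 with hc
  have hc0 : 0 < c := limitScale_neg_pos ha ha1 0
  -- Laws defined by recursion replace an actual Markov chain, so existence requires no construction
  -- of a process.
  let μ : ℕ → ProbabilityMeasure ℝ := fun n =>
    ⟨(localTimeLaw (-a) 0 n 0).map fun k : ℕ => (k : ℝ) / (n : ℝ) ^ a,
      Measure.isProbabilityMeasure_map (Measurable.of_discrete.aemeasurable)⟩
  have hμ0 : ∀ n, ∀ᵐ t ∂(μ n : Measure ℝ), 0 ≤ t := by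
    intro n
    change ∀ᵐ t ∂((localTimeLaw (-a) 0 n 0).map fun k : ℕ => (k : ℝ) / (n : ℝ) ^ a), 0 ≤ t
    rw [ae_map_iff (Measurable.of_discrete.aemeasurable) measurableSet_Ici]
    exact ae_of_all _ fun k => by positivity
  have hμ : ∀ s, 0 < s → Tendsto (fun n => ∫ t, Real.exp (-s * t) ∂(μ n : Measure ℝ)) atTop
      (nhds (mittagLeffler a (-(s * c)))) := by
    intro s hs
    refine (tendsto_localTimePgf_of_neg ha ha1 hs.le 0 0).congr fun n => ?_
    have hρ1 : Real.exp (-(s / (n : ℝ) ^ a)) ≤ 1 := by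
      rw [Real.exp_le_one_iff]
      have : 0 ≤ s / (n : ℝ) ^ a := by positivity
      linarith
    rw [← integral_pow_localTimeLaw hα (Real.exp_pos _).le hρ1]
    change _ = ∫ t, Real.exp (-s * t)
      ∂((localTimeLaw (-a) 0 n 0).map fun k : ℕ => (k : ℝ) / (n : ℝ) ^ a)
    rw [integral_map (Measurable.of_discrete.aemeasurable) (by fun_prop)]
    simp_rw [exp_neg_mul_natCast_div]
  obtain ⟨ν, hν0, hν, -⟩ := exists_tendsto_of_laplace_tendsto μ
    (fun s => mittagLeffler a (-(s * c))) hμ0 hμ (tendsto_mittagLeffler_neg_mul ha c)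
  -- The limit has transform `E_a(-s c)`; dividing by `c` normalizes it.
  have hm : Measurable fun t : ℝ => t / c := by fun_prop
  refine existsUnique_of_exists_of_unique
    ⟨⟨(ν : Measure ℝ).map fun t => t / c, Measure.isProbabilityMeasure_map hm.aemeasurable⟩,
      (isMittagLeffler_iff ha _).2 ⟨?_, fun s hs => ?_⟩⟩ fun M M' h h' => ?_
  · change ∀ᵐ t ∂((ν : Measure ℝ).map fun t => t / c), 0 ≤ t
    rw [ae_map_iff hm.aemeasurable measurableSet_Ici]
    filter_upwards [hν0] with t ht
    positivity
  · change ∫ t, Real.exp (-s * t) ∂((ν : Measure ℝ).map fun t => t / c) = mittagLeffler a (-s)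
    rw [integral_map hm.aemeasurable (by fun_prop)]
    rcases hs.eq_or_lt with rfl | hs
    · simp [mittagLeffler_zero]
    · have := hν (s / c) (by positivity)
      rw [div_mul_cancel₀ _ hc0.ne'] at this
      rw [← this]
      refine integral_congr_ae (ae_of_all _ fun t => ?_)
      change Real.exp _ = Real.exp _
      congr 1; ring
  · rw [isMittagLeffler_iff ha] at h h'
    have := M.2
    have := M'.2
    refine Subtype.ext (laplace_ext (μ := (M : Measure ℝ)) (ν := (M' : Measure ℝ)) h.1 h'.1
      fun n => ?_)
    rw [h.2 n n.cast_nonneg, h'.2 n n.cast_nonneg]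

/-! ### Convergence in law of the normalized local times -/

open Topology in
/-- Convergence in law of normalized local times from convergence of the generating functions. -/
theorem tendstoInDistribution_localTime {α : ℝ} (hα : -1 / 2 ≤ α)
    {Ω : Type*} [MeasurableSpace Ω] {x : ℕ} {P : Measure Ω} [IsProbabilityMeasure P]
    {S : ℕ → Ω → ℕ} (hS : IsMarkovChainFrom (gegenbauerTransition α) x P S) (y : ℕ)
    {L : ℕ → ℝ} (hL : ∀ n, 0 ≤ L n) {φ : ℝ → ℝ} (hφ0 : Tendsto φ (𝓝[>] 0) (𝓝 1))
    (hφ : ∀ s, 0 < s →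
      Tendsto (fun m => localTimePgf α (Real.exp (-(s / L m))) y m x) atTop (𝓝 (φ s)))
    {M : Measure ℝ} [IsProbabilityMeasure M] {Z : ℝ → ℝ} (hZ : Measurable Z)
    (hZ0 : ∀ᵐ t ∂M, 0 ≤ Z t) (hZφ : ∀ s, 0 < s → ∫ t, Real.exp (-s * Z t) ∂M = φ s) :
    TendstoInDistribution (fun (n : ℕ) (ω : Ω) => (localTime S n y ω : ℝ) / L n) atTop Z
      (fun _ => P) M := by
  have hX : ∀ n, Measurable fun ω => (localTime S n y ω : ℝ) / L n := fun n =>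
    (Measurable.of_discrete (f := fun k : ℕ => (k : ℝ) / L n)).comp (hS.measurable_localTime n y)
  refine ⟨fun n => (hX n).aemeasurable, hZ.aemeasurable, ?_⟩
  obtain ⟨ν, hν0, hν, hlim⟩ := exists_tendsto_of_laplace_tendsto (fun n =>
    ⟨P.map fun ω => (localTime S n y ω : ℝ) / L n,
      Measure.isProbabilityMeasure_map (hX n).aemeasurable⟩) φ
    (fun n => by
      change ∀ᵐ t ∂(P.map fun ω => (localTime S n y ω : ℝ) / L n), 0 ≤ t
      rw [ae_map_iff (hX n).aemeasurable measurableSet_Ici]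
      exact ae_of_all _ fun ω => div_nonneg (Nat.cast_nonneg _) (hL n))
    (fun s hs => by
      refine (hφ s hs).congr fun n => ?_
      rw [← integral_pow_localTime hα (Real.exp_pos _).le hS]
      change _ = ∫ t, Real.exp (-s * t) ∂(P.map fun ω => (localTime S n y ω : ℝ) / L n)
      rw [integral_map (hX n).aemeasurable (by fun_prop)]
      simp_rw [exp_neg_mul_natCast_div]) hφ0
  have h1 : IsProbabilityMeasure (M.map Z) := Measure.isProbabilityMeasure_map hZ.aemeasurable
  have h2 := ν.2
  -- The continuity theorem only provides some limit law; injectivity of the Laplace transform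
  -- identifies it with the law of `Z`.
  have hmap : M.map Z = ν := by
    refine laplace_ext (μ := M.map Z) (ν := (ν : Measure ℝ)) ?_ hν0 fun n => ?_
    · rwa [ae_map_iff hZ.aemeasurable measurableSet_Ici]
    · rcases Nat.eq_zero_or_pos n with rfl | hn
      · simp
      · have hn' : (0 : ℝ) < n := by exact_mod_cast hn
        rw [hν n hn', ← hZφ n hn', integral_map hZ.aemeasurable (by fun_prop)]
  rwa [show (⟨M.map Z, h1⟩ : ProbabilityMeasure ℝ) = ν from Subtype.ext hmap]

theorem ae_nonneg_expMeasure (r : ℝ) : ∀ᵐ t ∂(expMeasure r), 0 ≤ t := by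
  rw [expMeasure, gammaMeasure, ae_withDensity_iff (by
    exact (measurable_gammaPDFReal 1 r).ennreal_ofReal)]
  refine ae_of_all _ fun t ht => ?_
  by_contra hc
  exact ht (gammaPDF_of_neg (not_le.1 hc))

theorem laplace_expMeasure {r s : ℝ} (hr : 0 < r) (hs : 0 < s) :
    ∫ t, Real.exp (-s * t) ∂(expMeasure r) = r / (r + s) := by
  rw [expMeasure, gammaMeasure, integral_withDensity_eq_integral_toReal_smul
    (show Measurable (gammaPDF 1 r) from (measurable_gammaPDFReal 1 r).ennreal_ofReal)
    (ae_of_all _ fun t => show gammaPDF 1 r t < ⊤ from ENNReal.ofReal_lt_top)]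
  have h1 : ∀ t, (gammaPDF 1 r t).toReal • Real.exp (-s * t) =
      (Set.Ici (0 : ℝ)).indicator (fun t => r * Real.exp (-(r + s) * t)) t := by
    intro t
    have : gammaPDF 1 r t = exponentialPDF r t := rfl
    rw [this, exponentialPDF_eq]
    by_cases ht : 0 ≤ t
    · rw [if_pos ht, Set.indicator_of_mem (by exact ht), ENNReal.toReal_ofReal (by positivity),
        smul_eq_mul, mul_assoc, ← Real.exp_add]
      congr 2; ring
    · rw [if_neg ht, Set.indicator_of_notMem (by exact ht)]
      simp
  simp_rw [h1]
  rw [integral_indicator measurableSet_Ici, integral_Ici_eq_integral_Ioi, integral_const_mul,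
    integral_exp_mul_Ioi (by linarith), mul_zero, Real.exp_zero, neg_div_neg_eq, mul_one_div]

theorem proposition5p1 :
    (∀ α : ℝ, -1 / 2 ≤ α → α < 0 →
      (∃! M : ProbabilityMeasure ℝ, IsMittagLeffler |α| M) ∧
      ∀ M : ProbabilityMeasure ℝ, IsMittagLeffler |α| M →
      ∀ (x y : ℕ) (Ω : Type*) [MeasurableSpace Ω] (P : Measure Ω) [IsProbabilityMeasure P]
        (S : ℕ → Ω → ℕ), IsMarkovChainFrom (gegenbauerTransition α) x P S →
        TendstoInDistribution
          (fun (n : ℕ) (ω : Ω) => (localTime S n y ω : ℝ) / (n : ℝ) ^ |α|) atTop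
          (fun t : ℝ => limitScale α y * t) (fun _ => P) (M : Measure ℝ)) ∧
    (∀ (x y : ℕ) (Ω : Type*) [MeasurableSpace Ω] (P : Measure Ω) [IsProbabilityMeasure P]
        (S : ℕ → Ω → ℕ), IsMarkovChainFrom (gegenbauerTransition 0) x P S →
        TendstoInDistribution
          (fun (n : ℕ) (ω : Ω) => (localTime S n y ω : ℝ) / Real.log n) atTop
          (fun t : ℝ => t) (fun _ => P) (expMeasure (2 / (2 * (y : ℝ) + 1)))) := by
  refine ⟨fun α hα hα0 => ?_, fun x y Ω _ P _ S hS => ?_⟩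
  · obtain ⟨a, rfl⟩ : ∃ a, α = -a := ⟨-α, by ring⟩
    have ha : 0 < a := by linarith
    have ha1 : a ≤ 1 / 2 := by linarith
    rw [abs_neg, abs_of_pos ha]
    refine ⟨existsUnique_isMittagLeffler ha ha1, fun M hM x y Ω _ P _ S hS => ?_⟩
    have hc := limitScale_neg_pos ha ha1 y
    rw [isMittagLeffler_iff ha] at hM
    refine tendstoInDistribution_localTime hα hS y (fun n => by positivity)
      (tendsto_mittagLeffler_neg_mul ha (limitScale (-a) y))
      (fun s hs => tendsto_localTimePgf_of_neg ha ha1 hs.le x y) (by fun_prop) ?_ fun s hs => ?_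
    · filter_upwards [hM.1] with t ht
      positivity
    · rw [← hM.2 (s * limitScale (-a) y) (by positivity)]
      simp_rw [← mul_assoc, neg_mul]
  · have hα : (-1 / 2 : ℝ) ≤ 0 := by norm_num
    refine tendstoInDistribution_localTime hα hS y (fun n => Real.log_natCast_nonneg n)
      (φ := fun s => (1 + s * ((2 * y + 1) / 2))⁻¹) ?_
      (fun s hs => tendsto_localTimePgf_of_zero hs.le x y) measurable_id
      (ae_nonneg_expMeasure _) fun s hs => ?_
    · have hc : ContinuousAt (fun s : ℝ => (1 + s * ((2 * (y : ℝ) + 1) / 2))⁻¹) 0 :=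
        ContinuousAt.inv₀ (by fun_prop) (by simp)
      have := hc.tendsto.mono_left (nhdsWithin_le_nhds (s := Set.Ioi 0))
      simpa using this
    · rw [laplace_expMeasure (by positivity) hs]
      field_simp
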